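/- Let $n\ge 4$. Let $e_1,\dots,e_n$ be the standard basis of $\mathbb R^n$, and let the simple roots of type $\mathsf D_n$ be $\alpha_j=e_j-e_{j+1}$ for $1\le j\le n-1$ and $\alpha_n=e_{n-1}+e_n$ (Bourbaki's numbering), with highest root $\theta=e_1+e_2$, weight lattice $P$, and fundamental weights $\omega_i=e_1+\dots+e_i$ for $1\le i\le n-2$, $\omega_{n-1}=\tfrac12(e_1+\dots+e_{n-1}-e_n)$, $\omega_n=\tfrac12(e_1+\dots+e_n)$. Let $W_0=\langle s_1,\dots,s_n\rangle$ be the finite Weyl group, where $s_j$ is the reflection in $\alpha_j$, and let $\widetilde W=W_0\ltimes P$ be the extended affine Weyl group of type $\mathsf D_n^{(1)}$, regarded as a group of affine transformations of $\mathbb R^n$; a weight $\lambda\in P$ is identified with the translation $t_\lambda$. Put $s_0=t_\theta s_\theta$, where $s_\theta$ is the reflection in $\theta$. Let $\Lambda\subset\widetilde W$ be the subgroup of elements that permute $\{s_0,\dots,s_n\}$ by conjugation, so that $\widetilde W=\Lambda\ltimes\langle s_0,\dots,s_n\rangle$. The length $\ell(w)$ of $w\in\widetilde W$ is the least $r$ such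 that $w=\lambda s_{j_1}\cdots s_{j_r}$ for some $\lambda\in\Lambda$ and $j_1,\dots,j_r\in\{0,\dots,n\}$; such an expression is called reduced if $r=\ell(w)$. For $j\in\{1,n-1,n\}$ put $\pi_j=\omega_j w_j w_0$, where $w_0$ is the longest element of $W_0$ and $w_j$ is the longest element of the subgroup of $W_0$ generated by the $s_k$ with $1\le k\le n$, $k\ne j$. For $1\le k\le l$ write $[k,l]=s_ks_{k+1}\cdots s_l$ (so $[k,k]=s_k$), and for $2\le m\le n-2$ put \[ r_m=s_n\,[m,n-1]\,[m-1,n-2]. \] Then $\pi_1,\pi_{n-1},\pi_n\in\Lambda$, and the following hold in $\widetilde W$. If $i$ is even, then \[ \omega_i=\begin{cases} \big(s_0[2,n-1][1,n-2]s_n\big)^{i/2}\,[n-i,n-1]\cdots[2,i+1][1,i] & \text{if } 2\le i\le n-2,\\ \pi_{n-1}\,r_{n-2}r_{n-4}\cdots r_3\,s_n[1,n-1] & \text{if } i=n-1,\\ \pi_n\,r_{n-2}r_{n-4}\cdots r_2\,s_n & \text{if } i=n. \end{cases} \] If $i$ is odd, then \[ \omega_i=\begin{cases} \pi_1[1,n-2]s_n\big(s_0[2,n-1][1,n-2]s_n\big)^{(i-1)/2}\,[n-i,n-1]\cdots[2,i+1][1,i]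 & \text{if } 1\le i\le n-2,\\ \pi_{n-1}\,s_{n-1}s_{n-2}\,r_{n-3}r_{n-5}\cdots r_3\,s_n[1,n-1] & \text{if } i=n-1,\\ \pi_n\,s_{n-1}s_{n-2}\,r_{n-3}r_{n-5}\cdots r_2\,s_n & \text{if } i=n. \end{cases} \] Here the indices in the products of the $r_m$ decrease in steps of $2$, and such a product is empty if its first index is smaller than its last one (this happens only for $n=4$, $i=3$). Moreover, all these expressions are reduced, and \[ \ell(\omega_i)=i(2n-i-1)\quad(1\le i\le n-2),\qquad \ell(\omega_{n-1})=\ell(\omega_n)=\frac{n(n-1)}2. \] -/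

import Mathlib

noncomputable section

namespace AffineD

/-! The root system of type `D_n` in `ℝ^n` with Bourbaki's numbering. Coordinates, simple roots and
simple reflections are indexed by natural numbers, as on paper; only the indices `1, …, n`
(and `0` for the affine node) are meaningful. -/

/-- The standard basis vector `e_k` of `ℝ^n`, for `1 ≤ k ≤ n`. -/
def e (n k : ℕ) : Fin n → ℝ := fun a => if (a : ℕ) + 1 = k then 1 else 0

/-- The simple roots `α_j = e_j - e_{j+1}` for `1 ≤ j ≤ n - 1`, and `α_n = e_{n-1} + e_n`. -/
def simpleRoot (n j : ℕ) : Fin n → ℝ :=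
  if j < n then e n j - e n (j + 1) else e n (n - 1) + e n n

/-- The highest root `θ = e_1 + e_2`. -/
def highestRoot (n : ℕ) : Fin n → ℝ := e n 1 + e n 2

/-- The fundamental weights: `ω_i = e_1 + ⋯ + e_i` for `1 ≤ i ≤ n - 2`,
`ω_{n-1} = (e_1 + ⋯ + e_{n-1} - e_n) / 2` and `ω_n = (e_1 + ⋯ + e_{n-1} + e_n) / 2`. -/
def fundamentalWeight (n i : ℕ) : Fin n → ℝ :=
  if i + 2 ≤ n then ∑ k ∈ Finset.Icc 1 i, e n k
  else if i + 1 = n then (1 / 2 : ℝ) • (∑ k ∈ Finset.Icc 1 (n - 1), e n k - e n n)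
  else (1 / 2 : ℝ) • ∑ k ∈ Finset.Icc 1 n, e n k

theorem dot_e (n k : ℕ) (v : Fin n → ℝ) (hk : 1 ≤ k) (hkn : k ≤ n) :
    e n k ⬝ᵥ v = v ⟨k - 1, by omega⟩ := by
  unfold e dotProduct
  rw [Finset.sum_eq_single (⟨k - 1, by omega⟩ : Fin n)]
  · have : k - 1 + 1 = k := by omega
    simp [this]
  · intro b _ hb
    have : (b : ℕ) + 1 ≠ k := fun h => hb (Fin.ext (by simp; omega))
    simp [this]
  · simp

theorem sum_e_apply (n m : ℕ) (a : Fin n) :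
    (∑ k ∈ Finset.Icc 1 m, e n k) a = if (a : ℕ) + 1 ≤ m then 1 else 0 := by
  simp [e, Finset.sum_apply]

/-- The fundamental weights are dual to the simple (co)roots. -/
theorem simpleRoot_dot_fundamentalWeight (n i j : ℕ) (hn : 4 ≤ n) (hin : i ≤ n)
    (hj : 1 ≤ j) (hjn : j ≤ n) :
    simpleRoot n j ⬝ᵥ fundamentalWeight n i = if i = j then 1 else 0 := by
  have key : ∀ a : Fin n, fundamentalWeight n i a =
      if i + 2 ≤ n then (if (a : ℕ) + 1 ≤ i then 1 else 0)
      else if i + 1 = n ∧ (a : ℕ) + 1 = n then -(1 / 2) else 1 / 2 := by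
    intro a
    have := a.2
    unfold fundamentalWeight
    split_ifs <;> simp [sum_e_apply, -Finset.sum_apply, e] <;> grind
  unfold simpleRoot
  split_ifs with h1 h2 h2
  all_goals
    first
      | rw [sub_dotProduct]
      | rw [add_dotProduct]
    rw [dot_e n _ _ (by omega) (by omega), dot_e n _ _ (by omega) (by omega), key, key]
    grind

/-- The orthogonal reflection `x ↦ x - 2 (v, x) / (v, v) • v` in the hyperplane `v^⊥`, as a linear
map. -/
def reflLin (n : ℕ) (v : Fin n → ℝ) : (Fin n → ℝ) →ₗ[ℝ] (Fin n → ℝ) where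
  toFun x := x - (2 * (v ⬝ᵥ x) / (v ⬝ᵥ v)) • v
  map_add' x y := by
    rw [dotProduct_add]; module
  map_smul' c x := by
    rw [dotProduct_smul, smul_eq_mul, RingHom.id_apply]; module

theorem reflLin_involutive (n : ℕ) (v : Fin n → ℝ) : Function.Involutive (reflLin n v) := by
  intro x
  by_cases h : v ⬝ᵥ v = 0
  · simp [reflLin, h]
  · have : v ⬝ᵥ (x - (2 * (v ⬝ᵥ x) / (v ⬝ᵥ v)) • v) = -(v ⬝ᵥ x) := by
      rw [dotProduct_sub, dotProduct_smul, smul_eq_mul]; field_simp; ring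
    change (x - (2 * (v ⬝ᵥ x) / (v ⬝ᵥ v)) • v) -
      (2 * (v ⬝ᵥ (x - (2 * (v ⬝ᵥ x) / (v ⬝ᵥ v)) • v)) / (v ⬝ᵥ v)) • v = x
    rw [this]; module

/-- The group of affine transformations of `ℝ^n`; multiplication is composition. -/
abbrev AffineGroup (n : ℕ) := (Fin n → ℝ) ≃ᵃ[ℝ] (Fin n → ℝ)

/-- The reflection `s_v` as an affine transformation. -/
def refl (n : ℕ) (v : Fin n → ℝ) : AffineGroup n :=
  (LinearEquiv.ofInvolutive (reflLin n v) (reflLin_involutive n v)).toAffineEquiv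

/-- The translation `t_v : x ↦ v + x`. -/
def translation (n : ℕ) (v : Fin n → ℝ) : AffineGroup n :=
  AffineEquiv.constVAdd ℝ (Fin n → ℝ) v

/-- The simple reflections: `s_0 = t_θ s_θ` and `s_j = s_{α_j}` for `1 ≤ j ≤ n`. -/
def s (n j : ℕ) : AffineGroup n :=
  if j = 0 then translation n (highestRoot n) * refl n (highestRoot n)
  else refl n (simpleRoot n j)

/-- The set `{s_0, s_1, …, s_n}`. -/
def simpleReflections (n : ℕ) : Set (AffineGroup n) := s n '' Set.Icc 0 n

/-- The weight lattice `P`: the vectors that pair integrally with all simple coroots (which are the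
simple roots under the identification given by the standard scalar product). -/
def weightLattice (n : ℕ) : Set (Fin n → ℝ) :=
  {x | ∀ j, 1 ≤ j → j ≤ n → ∃ c : ℤ, simpleRoot n j ⬝ᵥ x = c}

/-- The extended affine Weyl group `W_0 ⋉ P`, as a group of affine transformations of `ℝ^n`:
generated by the finite Weyl group `W_0 = ⟨s_1, …, s_n⟩` and the translations by `P`. -/
def extAffineWeyl (n : ℕ) : Subgroup (AffineGroup n) :=
  Subgroup.closure (s n '' Set.Icc 1 n) ⊔ Subgroup.closure (translation n '' weightLattice n)

/-- The group `Λ` of diagram automorphisms in the extended affine Weyl group: the elements that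
permute the simple reflections `s_0, …, s_n` by conjugation. -/
def diagramGroup (n : ℕ) : Subgroup (AffineGroup n) :=
  extAffineWeyl n ⊓ Subgroup.normalizer (simpleReflections n)

/-- The product `s_{j_1} s_{j_2} ⋯ s_{j_r}` of a word `j_1, j_2, …, j_r`. -/
def wordProd (n : ℕ) (L : List ℕ) : AffineGroup n := (L.map (s n)).prod

/-- The length function of the extended affine Weyl group `Λ ⋉ W`: the least `r` such that
`g = lam s_{j_1} ⋯ s_{j_r}` with `lam ∈ Λ` and `j_1, …, j_r ∈ {0, …, n}`. -/
def extLength (n : ℕ) (g : AffineGroup n) : ℕ :=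
  sInf {r | ∃ lam ∈ diagramGroup n, ∃ L : List ℕ,
    (∀ j ∈ L, j ≤ n) ∧ L.length = r ∧ g = lam * wordProd n L}

/-- `g = lam s_{j_1} ⋯ s_{j_r}` is a reduced expression for `g`: `lam ∈ Λ`, the letters are in
`{0, …, n}`, and the number of letters is the length of `g`. -/
def IsReducedExpression (n : ℕ) (g lam : AffineGroup n) (L : List ℕ) : Prop :=
  lam ∈ diagramGroup n ∧ (∀ j ∈ L, j ≤ n) ∧ g = lam * wordProd n L ∧ L.length = extLength n g

/-! Longest elements of standard parabolic subgroups, and the elements `π_j` of `Λ`. -/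

/-- The Coxeter length on the parabolic subgroup `W_I = ⟨s_j | j ∈ I⟩`. -/
def parabolicLength (n : ℕ) (I : Set ℕ) (w : AffineGroup n) : ℕ :=
  sInf {r | ∃ L : List ℕ, (∀ j ∈ L, j ∈ I) ∧ L.length = r ∧ w = wordProd n L}

/-- `w` is an element of maximal length of `W_I`. -/
def IsLongest (n : ℕ) (I : Set ℕ) (w : AffineGroup n) : Prop :=
  w ∈ Subgroup.closure (s n '' I) ∧
    ∀ u ∈ Subgroup.closure (s n '' I), parabolicLength n I u ≤ parabolicLength n I w

/-- The longest element of `W_I` (used for finite `W_I`, where it exists and is unique). -/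
def longest (n : ℕ) (I : Set ℕ) : AffineGroup n := Classical.epsilon (IsLongest n I)

/-- `π_j = ω_j w_j w_0`, where `w_0` is the longest element of `W_0` and `w_j` is the longest element
of the parabolic subgroup obtained by removing the node `j`. -/
def diagramAut (n j : ℕ) : AffineGroup n :=
  translation n (fundamentalWeight n j) * longest n (Set.Icc 1 n \ {j}) * longest n (Set.Icc 1 n)

/-! Words in the letters `0, …, n`. -/

/-- The block `[k,l] = s_k s_{k+1} ⋯ s_l`, for `k ≤ l`. -/
def block (k l : ℕ) : List ℕ := List.range' k (l + 1 - k)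

/-- The `k`-th power of a word. -/
def wordPow (L : List ℕ) (k : ℕ) : List ℕ := (List.replicate k L).flatten

/-- The word `[n-i,n-1] [n-i-1,n-2] ⋯ [2,i+1] [1,i]`. -/
def cyclicWord (n i : ℕ) : List ℕ :=
  (List.range (n - i)).flatMap fun t => block (n - i - t) (n - 1 - t)

/-- `r_m = s_n [m,n-1] [m-1,n-2]`. -/
def rWord (n m : ℕ) : List ℕ := [n] ++ block m (n - 1) ++ block (m - 1) (n - 2)

/-- `r_a r_{a-2} r_{a-4} ⋯ r_b`, for `a ≡ b` modulo `2`; it is empty if `a < b`. -/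
def rChain (n a b : ℕ) : List ℕ :=
  (List.range ((a + 2 - b) / 2)).flatMap fun t => rWord n (a - 2 * t)

end AffineD

end

noncomputable section

namespace AffineD

/-! Each expression requires an identity of affine maps and a proof that no shorter word exists.

The identities are checked in coordinates, where every word acts by a signed permutation plus a
shift. The word $s_0[2,n-1][1,n-2]s_n$ rotates the coordinates two places to the right and adds 1 to
the two that wrap around (`coord_rotation`), and $\pi_1[1,n-2]s_n$ does the same by one place
(`coord_diagramAut_first_mul`). After $i$ places the cyclic word rotates everything back, and only
$t_{\omega_i}$ remains. For the two spin weights, the chain of $r_m$ builds the negated reversal of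
the coordinates, up to a correction at the ends (`coord_rChain`), which is what $\pi_{n-1}$ or
$\pi_n$ has to undo.

For minimality, let `sep` count the affine root hyperplanes between a generic point and the
fundamental alcove. A simple reflection raises it by at most 1 (`sep_s_le`). The point $\rho/h$ has
`sep` 0 and is fixed by $\Lambda$: it is the only point with equal values on all walls, and
$\Lambda$ permutes the walls by isometries (`diagramGroup_apply_basePoint`). Hence any expression of
$t_v$ has at least `sep` of $\rho/h-v$ letters, which is $\langle 2\rho,v\rangle$ for the weights in
question (`sep_basePoint_sub`). The given words have exactly this many letters.

It remains to see that $\pi_j\in\Lambda$. Since $\pi_j$ is defined by longest elements, these are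
first computed as explicit signed permutations (`SignedInvolution.map_eq_longest`): the Coxeter
length on a parabolic subgroup is again `sep` of the image of $\rho/h$, so a longest element makes
its simple roots negative there, and this determines it. In coordinates one then sees that $\pi_j$
permutes the $s_k$ by conjugation. -/

/-- The coordinate `x_k` of a vector, for `1 ≤ k ≤ n`, and `0` for other `k`. -/
def coord {n : ℕ} (x : Fin n → ℝ) (k : ℕ) : ℝ :=
  if h : 1 ≤ k ∧ k ≤ n then x ⟨k - 1, by omega⟩ else 0

/-! ### Simple reflections in coordinates -/

variable {n : ℕ}

theorem coord_ext {x y : Fin n → ℝ} (h : ∀ k, 1 ≤ k → k ≤ n → coord x k = coord y k) : x = y := by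
  ext a
  have := h (a + 1) (by omega) (by omega)
  simpa [coord, show (a : ℕ) + 1 ≤ n by omega] using this

theorem apply_eq_coord (x : Fin n → ℝ) (a : Fin n) : x a = coord x (a + 1) := by
  simp [coord, show (a : ℕ) + 1 ≤ n by omega]

theorem coord_of_fun (f : ℕ → ℝ) {k : ℕ} (h1 : 1 ≤ k) (h2 : k ≤ n) :
    coord (fun a : Fin n => f (a + 1)) k = f k := by
  simp [coord, h1, h2]

theorem coord_add (x y : Fin n → ℝ) (k : ℕ) : coord (x + y) k = coord x k + coord y k := by
  unfold coord; split_ifs <;> simp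

theorem coord_sub (x y : Fin n → ℝ) (k : ℕ) : coord (x - y) k = coord x k - coord y k := by
  unfold coord; split_ifs <;> simp

theorem coord_smul (c : ℝ) (x : Fin n → ℝ) (k : ℕ) : coord (c • x) k = c * coord x k := by
  unfold coord; split_ifs <;> simp

theorem coord_e {j : ℕ} (h1 : 1 ≤ j) (h2 : j ≤ n) (k : ℕ) :
    coord (e n j) k = if k = j then 1 else 0 := by
  unfold coord e
  split_ifs <;> grind

theorem dot_e' {j : ℕ} (h1 : 1 ≤ j) (h2 : j ≤ n) (x : Fin n → ℝ) : e n j ⬝ᵥ x = coord x j := by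
  rw [dot_e n j x h1 h2]; simp [coord, h1, h2]

theorem coord_fundamentalWeight (hn : 4 ≤ n) {i k : ℕ} (hk : 1 ≤ k) (hkn : k ≤ n) :
    coord (fundamentalWeight n i) k =
      if i + 2 ≤ n then (if k ≤ i then 1 else 0)
      else if i + 1 = n ∧ k = n then -(1 / 2) else 1 / 2 := by
  simp only [coord, hk, hkn, and_self, dite_true]
  unfold fundamentalWeight
  split_ifs <;> simp [sum_e_apply, -Finset.sum_apply, e] <;> grind

theorem simpleRoot_dot {j : ℕ} (hj : 1 ≤ j) (hjn : j < n) (x : Fin n → ℝ) :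
    simpleRoot n j ⬝ᵥ x = coord x j - coord x (j + 1) := by
  rw [simpleRoot, if_pos hjn, sub_dotProduct, dot_e' hj hjn.le, dot_e' (by omega) (by omega)]

theorem simpleRoot_last_dot (hn : 2 ≤ n) (x : Fin n → ℝ) :
    simpleRoot n n ⬝ᵥ x = coord x (n - 1) + coord x n := by
  rw [simpleRoot, if_neg (lt_irrefl n), add_dotProduct, dot_e' (by omega) (by omega),
    dot_e' (by omega) le_rfl]

theorem highestRoot_dot (hn : 2 ≤ n) (x : Fin n → ℝ) :
    highestRoot n ⬝ᵥ x = coord x 1 + coord x 2 := by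
  rw [highestRoot, add_dotProduct, dot_e' (by omega) (by omega), dot_e' (by omega) (by omega)]

theorem refl_apply (v x : Fin n → ℝ) :
    refl n v x = x - (2 * (v ⬝ᵥ x) / (v ⬝ᵥ v)) • v := rfl

theorem refl_involutive (v : Fin n → ℝ) : refl n v * refl n v = 1 := by
  ext1 x; exact reflLin_involutive n v x

theorem translation_apply (v x : Fin n → ℝ) : translation n v x = v + x := rfl

theorem coord_translation (v x : Fin n → ℝ) (k : ℕ) :
    coord (translation n v x) k = coord v k + coord x k := by
  rw [translation_apply, coord_add]

theorem simpleRoot_norm {j : ℕ} (hn : 2 ≤ n) (hj : 1 ≤ j) (hjn : j ≤ n) :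
    simpleRoot n j ⬝ᵥ simpleRoot n j = 2 := by
  rcases hjn.eq_or_lt with rfl | hjn
  · rw [simpleRoot_last_dot hn, simpleRoot, if_neg (lt_irrefl j)]
    simp only [coord_add, coord_e (show 1 ≤ j - 1 by omega) (show j - 1 ≤ j by omega),
      coord_e (show 1 ≤ j by omega) le_rfl]
    split_ifs <;> first | omega | norm_num
  · rw [simpleRoot_dot hj hjn, simpleRoot, if_pos hjn]
    simp only [coord_sub, coord_e hj hjn.le, coord_e (show 1 ≤ j + 1 by omega) hjn]
    norm_num

theorem highestRoot_norm (hn : 2 ≤ n) : highestRoot n ⬝ᵥ highestRoot n = 2 := by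
  rw [highestRoot_dot hn, highestRoot]
  simp only [coord_add, coord_e (show 1 ≤ 1 by omega) (show 1 ≤ n by omega),
    coord_e (show 1 ≤ 2 by omega) hn]
  norm_num

theorem coord_s {j : ℕ} (hj : 1 ≤ j) (hjn : j < n) (x : Fin n → ℝ) (k : ℕ) :
    coord (s n j x) k =
      if k = j then coord x (j + 1) else if k = j + 1 then coord x j else coord x k := by
  rw [s, if_neg (by omega), refl_apply, simpleRoot_norm (by omega) hj hjn.le, coord_sub,
    coord_smul, simpleRoot_dot hj hjn,
    simpleRoot, if_pos hjn]
  simp only [coord_sub, coord_e hj hjn.le, coord_e (show 1 ≤ j + 1 by omega) hjn]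
  split_ifs <;> grind

theorem coord_s_last (hn : 2 ≤ n) (x : Fin n → ℝ) (k : ℕ) :
    coord (s n n x) k =
      if k = n - 1 then -coord x n else if k = n then -coord x (n - 1) else coord x k := by
  rw [s, if_neg (by omega), refl_apply, simpleRoot_norm hn (by omega) le_rfl, coord_sub,
    coord_smul, simpleRoot_last_dot hn,
    simpleRoot, if_neg (lt_irrefl n)]
  simp only [coord_add, coord_e (show 1 ≤ n - 1 by omega) (show n - 1 ≤ n by omega),
      coord_e (show 1 ≤ n by omega) le_rfl]
  split_ifs <;> grind

theorem coord_s_zero (hn : 2 ≤ n) (x : Fin n → ℝ) (k : ℕ) :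
    coord (s n 0 x) k =
      if k = 1 then 1 - coord x 2 else if k = 2 then 1 - coord x 1 else coord x k := by
  rw [s, if_pos rfl]
  change coord (translation n _ (refl n _ x)) k = _
  rw [coord_translation, refl_apply, highestRoot_norm hn, coord_sub, coord_smul,
    highestRoot_dot hn, highestRoot]
  simp only [coord_add, coord_e (show 1 ≤ 1 by omega) (show 1 ≤ n by omega),
      coord_e (show 1 ≤ 2 by omega) hn]
  split_ifs <;> grind

theorem mul_self_s (hn : 2 ≤ n) (j : ℕ) : s n j * s n j = 1 := by
  by_cases h : j = 0
  · subst h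
    ext1 x
    refine coord_ext fun k _ _ => ?_
    change coord (s n 0 (s n 0 x)) k = coord x k
    simp only [coord_s_zero hn]
    grind
  · rw [s, if_neg h, refl_involutive]

/-! ### The action of words -/

theorem mul_apply (g h : AffineGroup n) (x : Fin n → ℝ) : (g * h) x = g (h x) := rfl

theorem wordProd_append (A B : List ℕ) : wordProd n (A ++ B) = wordProd n A * wordProd n B := by
  simp [wordProd]

theorem wordProd_singleton (j : ℕ) : wordProd n [j] = s n j := by simp [wordProd]

theorem wordProd_nil : wordProd n [] = 1 := rfl

theorem block_succ {k l : ℕ} (h : k ≤ l + 1) : block k (l + 1) = block k l ++ [l + 1] := by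
  unfold block
  rw [show l + 1 + 1 - k = (l + 1 - k) + 1 by omega, List.range'_concat]
  congr 2; omega

/-- The block is a cycle: it carries coordinate `l + 1` to place `k` and pushes the ones between one
place to the right. A letter appended on the right acts first, hence the induction with `x` general.
-/
theorem coord_block {k l : ℕ} (hk : 1 ≤ k) (hkl : k ≤ l) (hl : l < n) (x : Fin n → ℝ) (p : ℕ) :
    coord (wordProd n (block k l) x) p =
      if p = k then coord x (l + 1) else if k < p ∧ p ≤ l + 1 then coord x (p - 1)
      else coord x p := by
  induction l, hkl using Nat.le_induction generalizing x with
  | base =>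
    simp only [block, Nat.add_sub_cancel_left, List.range'_one, wordProd_singleton]
    rw [coord_s hk hl]
    grind
  | succ l hkl ih =>
    rw [block_succ (by omega), wordProd_append, wordProd_singleton, mul_apply, ih (by omega)]
    simp only [coord_s (show 1 ≤ l + 1 by omega) hl]
    grind

/-- Each block carries one coordinate to the left past `i` others, so together they exchange a group
of `i` with the group of `m` behind it. Here `m` plays the role of `n - i` in `cyclicWord`; freeing
it from `n` is what allows induction. -/
theorem coord_flatMap_block {i : ℕ} (hi : 1 ≤ i) (m : ℕ) (hm : m + i ≤ n) (x : Fin n → ℝ)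
    (p : ℕ) (hp : 1 ≤ p) :
    coord (wordProd n ((List.range m).flatMap fun t => block (m - t) (m + i - 1 - t)) x) p =
      if p ≤ m then coord x (p + i) else if p ≤ m + i then coord x (p - m) else coord x p := by
  induction m generalizing p with
  | zero => simp [wordProd_nil, show ¬ p ≤ 0 by omega]
  | succ m ih =>
    rw [List.range_succ_eq_map, List.flatMap_cons, List.flatMap_map, wordProd_append, mul_apply]
    have h : ∀ t, block (m + 1 - t.succ) (m + 1 + i - 1 - t.succ) =
        block (m - t) (m + i - 1 - t) := fun t => by congr 1 <;> omega
    simp only [h]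
    rw [coord_block (by omega) (by omega) (by omega)]
    split_ifs <;> rw [ih (by omega) _ (by omega)] <;> clear ih h <;> grind

theorem coord_cyclicWord {i : ℕ} (hi : 1 ≤ i) (hin : i ≤ n) (x : Fin n → ℝ) {p : ℕ} (hp : 1 ≤ p)
    (hpn : p ≤ n) :
    coord (wordProd n (cyclicWord n i) x) p =
      if p ≤ n - i then coord x (p + i) else coord x (p - (n - i)) := by
  have := coord_flatMap_block hi (n - i) (by omega) x p hp
  rw [show n - i + i = n by omega] at this
  rw [cyclicWord, this]
  grind

theorem wordProd_wordPow (L : List ℕ) (k : ℕ) : wordProd n (wordPow L k) = wordProd n L ^ k := by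
  induction k with
  | zero => rfl
  | succ k ih =>
    rw [pow_succ', ← ih, ← wordProd_append]; rfl

/-- The letter $s_n$ negates the last two coordinates, the blocks carry them to the front, and $s_0$
turns each negated value $-c$ into $1+c$; the two exchanges of order cancel. -/
theorem coord_rotation (hn : 4 ≤ n) (x : Fin n → ℝ) {p : ℕ} (hp : 1 ≤ p) (hpn : p ≤ n) :
    coord (wordProd n ([0] ++ block 2 (n - 1) ++ block 1 (n - 2) ++ [n]) x) p =
      if p ≤ 2 then 1 + coord x (n - 2 + p) else coord x (p - 2) := by
  simp only [wordProd_append, mul_apply, wordProd_singleton]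
  simp only [coord_s_zero (show 2 ≤ n by omega),
    coord_block (show 1 ≤ 2 by omega) (show 2 ≤ n - 1 by omega) (show n - 1 < n by omega),
    coord_block (show 1 ≤ 1 by omega) (show 1 ≤ n - 2 by omega) (show n - 2 < n by omega),
    coord_s_last (show 2 ≤ n by omega)]
  grind

theorem coord_rotation_pow (hn : 4 ≤ n) (k : ℕ) (hk : 2 * k ≤ n) (x : Fin n → ℝ) {p : ℕ}
    (hp : 1 ≤ p) (hpn : p ≤ n) :
    coord (wordProd n
        (wordPow ([0] ++ block 2 (n - 1) ++ block 1 (n - 2) ++ [n]) k) x) p =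
      if p ≤ 2 * k then 1 + coord x (n - 2 * k + p) else coord x (p - 2 * k) := by
  rw [wordProd_wordPow]
  induction k generalizing p with
  | zero => simp [show ¬ p ≤ 0 by omega]
  | succ k ih =>
    rw [pow_succ', mul_apply, coord_rotation hn _ hp hpn]
    split_ifs <;> rw [ih (by omega) (by omega) (by omega)] <;> grind

/-- The two blocks carry the last two coordinates to the places `m - 1` and `m`, shifting the ones
in between by two; then $s_n$ exchanges and negates the pair that has arrived at the end. -/
theorem coord_rWord {m : ℕ} (hm : 2 ≤ m) (hmn : m + 2 ≤ n) (x : Fin n → ℝ) {p : ℕ} (hp : 1 ≤ p)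
    (hpn : p ≤ n) :
    coord (wordProd n (rWord n m) x) p =
      if p + 2 ≤ m then coord x p else if p ≤ m then coord x (n + p - m)
      else if p + 2 ≤ n then coord x (p - 2) else -coord x (2 * n - 3 - p) := by
  simp only [rWord, wordProd_append, mul_apply, wordProd_singleton]
  simp only [coord_s_last (show 2 ≤ n by omega),
    coord_block (show 1 ≤ m by omega) (show m ≤ n - 1 by omega) (show n - 1 < n by omega),
    coord_block (show 1 ≤ m - 1 by omega) (show m - 1 ≤ n - 2 by omega) (show n - 2 < n by omega)]
  grind

theorem rChain_succ (n b t : ℕ) :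
    rChain n (b + 2 * (t + 1)) b = rWord n (b + 2 * (t + 1)) ++ rChain n (b + 2 * t) b := by
  unfold rChain
  rw [show (b + 2 * (t + 1) + 2 - b) / 2 = (b + 2 * t + 2 - b) / 2 + 1 by omega,
    List.range_succ_eq_map, List.flatMap_cons, List.flatMap_map]
  congr 2
  funext u
  congr 1
  omega

theorem rChain_self (n b : ℕ) : rChain n b b = rWord n b := by
  simp [rChain]

theorem rChain_of_lt {a b : ℕ} (h : a < b) : rChain n a b = [] := by
  simp [rChain, show (a + 2 - b) / 2 = 0 by omega]

/-- Each factor leaves an exchanged and negated pair at the end, and the factor to its left inserts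
this pair just behind the previous one. So the chain writes the coordinates in reverse order with
minus signs, two at a time. -/
theorem coord_rChain {b t : ℕ} (hb : 2 ≤ b) (hbn : b + 2 * t + 2 ≤ n) (x : Fin n → ℝ) {p : ℕ}
    (hp : 1 ≤ p) (hpn : p ≤ n) :
    coord (wordProd n (rChain n (b + 2 * t) b) x) p =
      if p + 2 ≤ b then coord x p else if p ≤ b then coord x (n + p - b)
      else if p ≤ b + 2 * t then -coord x (n + b - 1 - p)
      else if p + 2 ≤ n then coord x (p - 2 * (t + 1)) else -coord x (2 * n - 2 * t - 3 - p) := by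
  induction t generalizing p with
  | zero =>
    rw [Nat.mul_zero, Nat.add_zero, rChain_self, coord_rWord hb (by omega) x hp hpn]
    grind
  | succ t ih =>
    rw [rChain_succ, wordProd_append, mul_apply,
      coord_rWord (by omega) (by omega) _ hp hpn]
    split_ifs <;> rw [ih (by omega) (by omega) (by omega)] <;> grind

/-! ### Lengths of the words and range of their letters -/

theorem length_block (k l : ℕ) : (block k l).length = l + 1 - k := by simp [block]

theorem length_wordPow (L : List ℕ) (k : ℕ) : (wordPow L k).length = k * L.length := by
  simp [wordPow]

theorem length_cyclicWord {n i : ℕ} (hi : 1 ≤ i) (hin : i ≤ n) :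
    (cyclicWord n i).length = (n - i) * i := by
  rw [cyclicWord, List.length_flatMap, List.map_congr_left (g := fun _ => i)]
  · simp
  · intro t ht
    have := List.mem_range.1 ht
    rw [length_block]; omega

theorem length_rWord {n m : ℕ} (hm : 2 ≤ m) (hmn : m ≤ n) :
    (rWord n m).length = 2 * (n - m) + 1 := by
  simp [rWord, length_block]; omega

theorem length_rChain {n b t : ℕ} (hb : 2 ≤ b) (hbn : b + 2 * t ≤ n) :
    (rChain n (b + 2 * t) b).length = (t + 1) * (2 * (n - b - t) + 1) := by
  induction t with
  | zero => simp [rChain_self, length_rWord hb (show b ≤ n by omega)]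
  | succ t ih =>
    rw [rChain_succ, List.length_append, ih (by omega), length_rWord (by omega) hbn]
    obtain ⟨d, rfl⟩ := Nat.exists_eq_add_of_le hbn
    rw [show b + 2 * (t + 1) + d - (b + 2 * (t + 1)) = d by omega,
      show b + 2 * (t + 1) + d - b - t = d + t + 2 by omega,
      show b + 2 * (t + 1) + d - b - (t + 1) = d + t + 1 by omega]
    ring

theorem le_of_mem_block {k l j N : ℕ} (hl : l ≤ N) (h : j ∈ block k l) : j ≤ N := by
  simp [block] at h; omega

theorem le_of_mem_wordPow {L : List ℕ} {k j N : ℕ} (hL : ∀ j ∈ L, j ≤ N) (h : j ∈ wordPow L k) :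
    j ≤ N := by
  simp only [wordPow, List.mem_flatten, List.mem_replicate] at h
  obtain ⟨M, ⟨-, rfl⟩, hj⟩ := h
  exact hL j hj

theorem le_of_mem_cyclicWord {i j : ℕ} (h : j ∈ cyclicWord n i) : j ≤ n := by
  simp only [cyclicWord, List.mem_flatMap] at h
  obtain ⟨t, -, h⟩ := h
  exact le_of_mem_block (by omega) h

theorem le_of_mem_rChain {a b j : ℕ} (h : j ∈ rChain n a b) : j ≤ n := by
  simp only [rChain, List.mem_flatMap, rWord, List.mem_append, List.mem_singleton] at h
  obtain ⟨t, -, (rfl | h) | h⟩ := h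
  · exact le_rfl
  · exact le_of_mem_block (by omega) h
  · exact le_of_mem_block (by omega) h

/-! ### Counting separating hyperplanes -/

/-- The number of hyperplanes orthogonal to `e_a - e_b` or `e_a + e_b` that separate a point with
coordinates `x_a = u`, `x_b = v` from the fundamental alcove, if the point lies on none of them. -/
def pairSep (u v : ℝ) : ℤ := |⌊u - v⌋| + |⌊u + v⌋|

/-- The pairs `(a, b)` with `1 ≤ a < b ≤ n`. -/
def indexPairs (n : ℕ) : Finset (ℕ × ℕ) :=
  (Finset.Icc 1 n ×ˢ Finset.Icc 1 n).filter fun q => q.1 < q.2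

theorem mem_indexPairs {q : ℕ × ℕ} : q ∈ indexPairs n ↔ 1 ≤ q.1 ∧ q.1 < q.2 ∧ q.2 ≤ n := by
  simp [indexPairs]; omega

/-- The number of affine root hyperplanes that separate a generic point from the fundamental
alcove. -/
def sep (x : Fin n → ℝ) : ℤ := ∑ q ∈ indexPairs n, pairSep (coord x q.1) (coord x q.2)

/-- A real number which is not an integer. -/
def NotInt (t : ℝ) : Prop := ∀ m : ℤ, t ≠ m

theorem NotInt.int_add {t : ℝ} (h : NotInt t) (k : ℤ) : NotInt (k + t) := by
  intro m hm
  exact h (m - k) (by push_cast; linarith)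

theorem NotInt.int_sub {t : ℝ} (h : NotInt t) (k : ℤ) : NotInt (k - t) := by
  intro m hm
  exact h (k - m) (by push_cast; linarith)

theorem NotInt.of_pos_of_lt_one {t : ℝ} (h0 : 0 < t) (h1 : t < 1) : NotInt t := by
  rintro m rfl
  have : (0 : ℤ) < m := by exact_mod_cast h0
  have : m < (1 : ℤ) := by exact_mod_cast h1
  omega

theorem NotInt.floor_neg {t : ℝ} (h : NotInt t) : ⌊-t⌋ = -⌊t⌋ - 1 := by
  rw [Int.floor_eq_iff]
  have h1 := Int.floor_le t
  have h2 := Int.lt_floor_add_one t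
  have h3 := h ⌊t⌋
  have h4 : (⌊t⌋ : ℝ) < t := lt_of_le_of_ne h1 (Ne.symm h3)
  push_cast
  constructor <;> linarith

theorem NotInt.floor_int_sub {t : ℝ} (h : NotInt t) (k : ℤ) : ⌊k - t⌋ = k - ⌊t⌋ - 1 := by
  rw [sub_eq_add_neg, Int.floor_intCast_add, h.floor_neg]; ring

/-- Among the levels `t = m`, the sign change preserves the count of those separating from `0 < t <
1` except for `m = 0`, which it crosses. This is the source of the ±1 in `sep_s`. -/
theorem NotInt.abs_floor_neg {t : ℝ} (h : NotInt t) :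
    |⌊-t⌋| = |⌊t⌋| + if 0 < t then 1 else -1 := by
  rw [h.floor_neg]
  split_ifs with h0
  · have : 0 ≤ ⌊t⌋ := Int.floor_nonneg.2 h0.le
    grind
  · have h0' : t < 0 := lt_of_le_of_ne (not_lt.1 h0) (by simpa using h 0)
    have : ⌊t⌋ < 0 := Int.floor_lt_zero.2 h0'
    grind

/-- A point on no hyperplane `x_a ± x_b = m` with `m ∈ ℤ`. -/
def Generic (x : Fin n → ℝ) : Prop :=
  ∀ a b, 1 ≤ a → a ≤ n → 1 ≤ b → b ≤ n → a ≠ b →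
    NotInt (coord x a - coord x b) ∧ NotInt (coord x a + coord x b)

theorem Generic.of_signed_perm {x y : Fin n → ℝ} (hx : Generic x) (τ : ℕ → ℕ)
    (hτ : ∀ a, 1 ≤ a → a ≤ n → 1 ≤ τ a ∧ τ a ≤ n)
    (hinj : ∀ a b, 1 ≤ a → a ≤ n → 1 ≤ b → b ≤ n → τ a = τ b → a = b)
    (h : ∀ a, 1 ≤ a → a ≤ n → coord y a = coord x (τ a) ∨
      ∃ k : ℤ, coord y a = k - coord x (τ a)) : Generic y := by
  intro a b ha han hb hbn hab
  obtain ⟨h1, h2⟩ := hx (τ a) (τ b) (hτ a ha han).1 (hτ a ha han).2 (hτ b hb hbn).1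
    (hτ b hb hbn).2 (fun h => hab (hinj a b ha han hb hbn h))
  rcases h a ha han with ea | ⟨k, ea⟩ <;> rcases h b hb hbn with eb | ⟨l, eb⟩ <;> rw [ea, eb]
  · exact ⟨h1, h2⟩
  · constructor
    · convert h2.int_add (-l) using 1; push_cast; ring
    · convert h1.int_add l using 1; ring
  · constructor
    · convert h2.int_sub k using 1; ring
    · convert h1.int_sub k using 1; ring
  · constructor
    · convert h1.int_sub (k - l) using 1; push_cast; ring
    · convert h2.int_sub (k + l) using 1; push_cast; ring

theorem generic_s {j : ℕ} (hn : 2 ≤ n) (hj : j ≤ n) {x : Fin n → ℝ} (hx : Generic x) :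
    Generic (s n j x) := by
  rcases Nat.eq_zero_or_pos j with rfl | hj0
  · refine hx.of_signed_perm (fun a => if a = 1 then 2 else if a = 2 then 1 else a)
      (by grind) (by grind) fun a ha han => ?_
    simp only [coord_s_zero hn]
    split_ifs
    · exact Or.inr ⟨1, by simp⟩
    · exact Or.inr ⟨1, by simp⟩
    · exact Or.inl rfl
  rcases hj.eq_or_lt with rfl | hjn
  · refine hx.of_signed_perm (fun a => if a = j - 1 then j else if a = j then j - 1 else a)
      (by grind) (by grind) fun a ha han => ?_
    simp only [coord_s_last hn]
    split_ifs
    · exact Or.inr ⟨0, by simp⟩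
    · exact Or.inr ⟨0, by simp⟩
    · exact Or.inl rfl
  · refine hx.of_signed_perm (fun a => if a = j then j + 1 else if a = j + 1 then j else a)
      (by grind) (by grind) fun a ha han => ?_
    simp only [coord_s hj0 hjn]
    split_ifs <;> exact Or.inl rfl

/-! ### Effect of a simple reflection on the count -/

/-- The transposition of `p` and `p + 1`. -/
def adjSwap (p a : ℕ) : ℕ := if a = p then p + 1 else if a = p + 1 then p else a

/-- Exchanging `p` and `p + 1` preserves the order inside every pair other than `(p, p + 1)`, so it
permutes those pairs and their contributions; only the pair `(p, p + 1)` is accounted for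
separately. -/
theorem sep_adjSwap {x y : Fin n → ℝ} {p : ℕ} (hp : 1 ≤ p) (hpn : p + 1 ≤ n)
    (h : ∀ a b, 1 ≤ a → a < b → b ≤ n → ¬ (a = p ∧ b = p + 1) →
      pairSep (coord y a) (coord y b) = pairSep (coord x (adjSwap p a)) (coord x (adjSwap p b))) :
    sep y = sep x - pairSep (coord x p) (coord x (p + 1))
      + pairSep (coord y p) (coord y (p + 1)) := by
  have hm : (p, p + 1) ∈ indexPairs n := mem_indexPairs.2 ⟨hp, by omega, hpn⟩
  unfold sep
  rw [← Finset.sum_erase_add _ _ hm, ← Finset.sum_erase_add (indexPairs n)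
    (fun q => pairSep (coord x q.1) (coord x q.2)) hm]
  simp only [add_sub_cancel_right, add_left_inj]
  refine Finset.sum_nbij' (fun q => (adjSwap p q.1, adjSwap p q.2))
    (fun q => (adjSwap p q.1, adjSwap p q.2)) ?_ ?_ ?_ ?_ ?_
  · rintro ⟨a, b⟩ hq
    simp only [Finset.mem_erase, mem_indexPairs, ne_eq, Prod.mk.injEq] at hq ⊢
    grind [adjSwap]
  · rintro ⟨a, b⟩ hq
    simp only [Finset.mem_erase, mem_indexPairs, ne_eq, Prod.mk.injEq] at hq ⊢
    grind [adjSwap]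
  · rintro ⟨a, b⟩ -
    simp only [Prod.mk.injEq]
    grind [adjSwap]
  · rintro ⟨a, b⟩ -
    simp only [Prod.mk.injEq]
    grind [adjSwap]
  · rintro ⟨a, b⟩ hq
    simp only [Finset.mem_erase, mem_indexPairs, ne_eq, Prod.mk.injEq] at hq
    exact h a b hq.2.1 hq.2.2.1 hq.2.2.2 hq.1

theorem sep_s {j : ℕ} (hn : 2 ≤ n) (hj : 1 ≤ j) (hjn : j ≤ n) {x : Fin n → ℝ} (hx : Generic x) :
    sep (s n j x) = sep x + if 0 < simpleRoot n j ⬝ᵥ x then 1 else -1 := by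
  rcases hjn.eq_or_lt with rfl | hjn
  · have key := sep_adjSwap (x := x) (y := s j j x) (p := j - 1) (by omega) (by omega)
      (fun a b ha hab hb hne => by
        simp only [coord_s_last hn]
        -- A sign change of the second coordinate just exchanges the families $e_a-e_b$ and
        -- $e_a+e_b$. The first coordinate never changes sign, because the pair `(j - 1, j)` is
        -- excluded.
        have : ∀ u v : ℝ, pairSep u (-v) = pairSep u v := fun u v => by
          unfold pairSep; rw [add_comm]; simp [sub_eq_add_neg]
        have h1 : j - 1 + 1 = j := by omega
        unfold adjSwap
        grind)
    rw [show j - 1 + 1 = j by omega] at key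
    have hF := (hx (j - 1) j (by omega) (by omega) (by omega) (by omega) (by omega)).2
    rw [key, simpleRoot_last_dot hn]
    simp only [coord_s_last hn, if_true, if_neg (show j ≠ j - 1 by omega)]
    have := hF.abs_floor_neg
    unfold pairSep
    rw [show -coord x j - -coord x (j - 1) = coord x (j - 1) - coord x j by ring,
      show -coord x j + -coord x (j - 1) = -(coord x (j - 1) + coord x j) by ring, this]
    ring
  · have key := sep_adjSwap (x := x) (y := s n j x) hj hjn (fun a b ha hab hb hne => by
        simp only [coord_s hj hjn, adjSwap]
        grind)
    have hF := (hx j (j + 1) (by omega) (by omega) (by omega) (by omega) (by omega)).1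
    rw [key, simpleRoot_dot hj hjn]
    simp only [coord_s hj hjn, if_true, if_neg (show j + 1 ≠ j by omega)]
    have := hF.abs_floor_neg
    unfold pairSep
    rw [← neg_sub (coord x j) (coord x (j + 1)), this, add_comm (coord x (j + 1))]
    ring

/-- For a pair with one index in {1, 2}, the map $t\mapsto 1-t$ preserves the strip $0<t<1$ and
hence the count. For the pair (1, 2) only $e_1+e_2$ changes, from floor $f$ to $1-f$. The inequality
is all that the lower bound on lengths needs. -/
theorem sep_s_zero_le (hn : 2 ≤ n) {x : Fin n → ℝ} (hx : Generic x) :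
    sep (s n 0 x) ≤ sep x + 1 := by
  have key := sep_adjSwap (x := x) (y := s n 0 x) (p := 1) le_rfl hn
    (fun a b ha hab hb hne => by
      have hb3 : 3 ≤ b := by omega
      have haux : ∀ u v : ℝ, NotInt (u - v) → NotInt (u + v) →
          pairSep (1 - u) v = pairSep u v := fun u v h1 h2 => by
        have e1 := h2.floor_int_sub 1
        have e2 := h1.floor_int_sub 1
        unfold pairSep
        rw [show 1 - u - v = ((1 : ℤ) : ℝ) - (u + v) by push_cast; ring,
          show 1 - u + v = ((1 : ℤ) : ℝ) - (u - v) by push_cast; ring, e1, e2]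
        grind
      simp only [coord_s_zero hn, adjSwap]
      rw [if_neg (show b ≠ 1 by omega), if_neg (show b ≠ 2 by omega),
        if_neg (show b ≠ 1 by omega), if_neg (show b ≠ 1 + 1 by omega)]
      split_ifs with h1 h2
      · exact haux _ _ (hx 2 b (by omega) (by omega) (by omega) (by omega) (by omega)).1
          (hx 2 b (by omega) (by omega) (by omega) (by omega) (by omega)).2
      · exact haux _ _ (hx 1 b (by omega) (by omega) (by omega) (by omega) (by omega)).1
          (hx 1 b (by omega) (by omega) (by omega) (by omega) (by omega)).2
      · rfl)
  have hF := (hx 1 2 (by omega) (by omega) (by omega) (by omega) (by omega)).2.floor_int_sub 2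
  rw [key]
  simp only [coord_s_zero hn, Nat.reduceAdd, if_true, if_neg (show 2 ≠ 1 by omega)]
  unfold pairSep
  rw [show 1 - coord x 2 - (1 - coord x 1) = coord x 1 - coord x 2 by ring,
    show 1 - coord x 2 + (1 - coord x 1) = ((2 : ℤ) : ℝ) - (coord x 1 + coord x 2) by
      push_cast; ring, hF]
  grind

theorem sep_s_le {j : ℕ} (hn : 2 ≤ n) (hj : j ≤ n) {x : Fin n → ℝ} (hx : Generic x) :
    sep (s n j x) ≤ sep x + 1 := by
  rcases Nat.eq_zero_or_pos j with rfl | hj0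
  · exact sep_s_zero_le hn hx
  · rw [sep_s hn hj0 hj hx]
    split_ifs <;> omega

theorem wordProd_cons (j : ℕ) (L : List ℕ) : wordProd n (j :: L) = s n j * wordProd n L := by
  simp [wordProd]

theorem generic_wordProd (hn : 2 ≤ n) {L : List ℕ} (hL : ∀ j ∈ L, j ≤ n) {x : Fin n → ℝ}
    (hx : Generic x) : Generic (wordProd n L x) := by
  induction L with
  | nil => exact hx
  | cons j L ih =>
    rw [wordProd_cons, mul_apply]
    exact generic_s hn (hL j (by simp)) (ih fun i hi => hL i (by simp [hi]))

theorem sep_wordProd_le (hn : 2 ≤ n) {L : List ℕ} (hL : ∀ j ∈ L, j ≤ n) {x : Fin n → ℝ}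
    (hx : Generic x) : sep (wordProd n L x) ≤ sep x + L.length := by
  induction L with
  | nil => simp [wordProd_nil]
  | cons j L ih =>
    have hL' : ∀ i ∈ L, i ≤ n := fun i hi => hL i (by simp [hi])
    rw [wordProd_cons, mul_apply]
    have := sep_s_le hn (hL j (by simp)) (generic_wordProd hn hL' hx)
    have := ih hL'
    push_cast [List.length_cons]
    linarith

theorem wordProd_reverse_mul (hn : 2 ≤ n) (L : List ℕ) :
    wordProd n L.reverse * wordProd n L = 1 := by
  induction L with
  | nil => simp [wordProd_nil]
  | cons j L ih =>
    rw [List.reverse_cons, wordProd_append, wordProd_singleton, wordProd_cons, mul_assoc,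
      ← mul_assoc (s n j), mul_self_s hn, one_mul, ih]

/-! ### The base point -/

/-- The point `ρ / h` of the fundamental alcove, where `h = 2n - 2` is the Coxeter number. -/
def basePoint (n : ℕ) : Fin n → ℝ := fun a => ((n : ℝ) - ((a + 1 : ℕ) : ℝ)) / (2 * n - 2)

theorem coord_basePoint {k : ℕ} (h1 : 1 ≤ k) (h2 : k ≤ n) :
    coord (basePoint n) k = ((n : ℝ) - k) / (2 * n - 2) :=
  coord_of_fun (fun k => ((n : ℝ) - k) / (2 * n - 2)) h1 h2

theorem basePoint_sub {a b : ℕ} (ha : 1 ≤ a) (hab : a < b) (hb : b ≤ n) :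
    0 < coord (basePoint n) a - coord (basePoint n) b ∧
      coord (basePoint n) a - coord (basePoint n) b < 1 := by
  have h1 : (1 : ℝ) ≤ a := by exact_mod_cast ha
  have h2 : (a : ℝ) + 1 ≤ b := by exact_mod_cast hab
  have h3 : (b : ℝ) ≤ n := by exact_mod_cast hb
  have hp : (0 : ℝ) < 2 * n - 2 := by linarith
  rw [coord_basePoint ha (by omega), coord_basePoint (by omega) hb, ← sub_div, lt_div_iff₀ hp,
    div_lt_iff₀ hp]
  constructor <;> linarith

theorem basePoint_add {a b : ℕ} (ha : 1 ≤ a) (hab : a < b) (hb : b ≤ n) :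
    0 < coord (basePoint n) a + coord (basePoint n) b ∧
      coord (basePoint n) a + coord (basePoint n) b < 1 := by
  have h1 : (1 : ℝ) ≤ a := by exact_mod_cast ha
  have h2 : (a : ℝ) + 1 ≤ b := by exact_mod_cast hab
  have h3 : (b : ℝ) ≤ n := by exact_mod_cast hb
  have hp : (0 : ℝ) < 2 * n - 2 := by linarith
  rw [coord_basePoint ha (by omega), coord_basePoint (by omega) hb, ← add_div, lt_div_iff₀ hp,
    div_lt_iff₀ hp]
  constructor <;> linarith

theorem generic_basePoint : Generic (basePoint n) := by
  intro a b ha han hb hbn hab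
  rcases lt_or_gt_of_ne hab with h | h
  · obtain ⟨h1, h2⟩ := basePoint_sub ha h hbn
    obtain ⟨h3, h4⟩ := basePoint_add ha h hbn
    exact ⟨.of_pos_of_lt_one h1 h2, .of_pos_of_lt_one h3 h4⟩
  · obtain ⟨h1, h2⟩ := basePoint_sub hb h han
    obtain ⟨h3, h4⟩ := basePoint_add hb h han
    refine ⟨?_, .of_pos_of_lt_one (by linarith) (by linarith)⟩
    convert (NotInt.of_pos_of_lt_one h1 h2).int_sub 0 using 1
    push_cast; ring

/-- All positive roots take values in $(0,1)$ at the base point, so each counts exactly its value on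
$v$. A pair contributes $(v_a-v_b)+(v_a+v_b)=2v_a$, and $a$ is the smaller index of $n-a$ pairs; the
sum is $\langle 2\rho,v\rangle$. -/
theorem sep_basePoint_sub {v : Fin n → ℝ}
    (hv : ∀ a b, 1 ≤ a → a < b → b ≤ n → ∃ k l : ℤ, 0 ≤ k ∧ 0 ≤ l ∧
      coord v a - coord v b = k ∧ coord v a + coord v b = l) :
    (sep (basePoint n - v) : ℝ) = ∑ a ∈ Finset.Icc 1 n, 2 * ((n : ℝ) - a) * coord v a := by
  have h1 : ∀ q ∈ indexPairs n, (pairSep (coord (basePoint n - v) q.1)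
      (coord (basePoint n - v) q.2) : ℝ) = 2 * coord v q.1 := by
    rintro ⟨a, b⟩ hq
    obtain ⟨ha, hab, hb⟩ := mem_indexPairs.1 hq
    obtain ⟨k, l, hk, hl, ek, el⟩ := hv a b ha hab hb
    obtain ⟨h1, h2⟩ := basePoint_sub ha hab hb
    obtain ⟨h3, h4⟩ := basePoint_add ha hab hb
    have f1 : ⌊coord (basePoint n) a - coord (basePoint n) b⌋ = 0 :=
      Int.floor_eq_zero_iff.2 ⟨h1.le, h2⟩
    have f2 : ⌊coord (basePoint n) a + coord (basePoint n) b⌋ = 0 :=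
      Int.floor_eq_zero_iff.2 ⟨h3.le, h4⟩
    unfold pairSep
    simp only [coord_sub]
    rw [show ∀ p q r t : ℝ, p - q - (r - t) = p - r - (q - t) by intros; ring,
      show ∀ p q r t : ℝ, p - q + (r - t) = p + r - (q + t) by intros; ring, ek, el,
      Int.floor_sub_intCast, Int.floor_sub_intCast, f1, f2, zero_sub, zero_sub, abs_neg, abs_neg,
      abs_of_nonneg hk, abs_of_nonneg hl]
    push_cast
    rw [← ek, ← el]
    ring
  unfold sep
  push_cast
  rw [Finset.sum_congr rfl h1, Finset.sum_finset_product (indexPairs n) (Finset.Icc 1 n)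
    (fun a => Finset.Ioc a n) fun q => by
      rw [mem_indexPairs, Finset.mem_Icc, Finset.mem_Ioc]; omega]
  refine Finset.sum_congr rfl fun a ha => ?_
  simp only [Finset.sum_const, Nat.card_Ioc, nsmul_eq_mul]
  rw [Nat.cast_sub (Finset.mem_Icc.1 ha).2]
  ring

theorem sep_basePoint : sep (basePoint n) = 0 := by
  have := sep_basePoint_sub (n := n) (v := 0)
    (fun a b _ _ _ => ⟨0, 0, le_rfl, le_rfl, by simp [coord], by simp [coord]⟩)
  have h0 : ∀ k, coord (0 : Fin n → ℝ) k = 0 := fun k => by simp [coord]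
  simp only [sub_zero, h0, mul_zero, Finset.sum_const_zero] at this
  exact_mod_cast this

/-! ### The group `Λ` fixes the base point -/

/-- The affine function that vanishes on the wall of the fundamental alcove fixed by `s_j`. -/
def wall (n j : ℕ) (x : Fin n → ℝ) : ℝ :=
  if j = 0 then 1 - highestRoot n ⬝ᵥ x else simpleRoot n j ⬝ᵥ x

/-- Displacement lengths are invariant under isometries, so this expresses the wall values, up to
sign, in a form that conjugation by $\Lambda$ respects. -/
theorem s_sub_self_norm {j : ℕ} (hn : 2 ≤ n) (hjn : j ≤ n) (x : Fin n → ℝ) :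
    (s n j x - x) ⬝ᵥ (s n j x - x) = 2 * wall n j x ^ 2 := by
  rcases Nat.eq_zero_or_pos j with rfl | hj
  · have : s n 0 x - x = wall n 0 x • highestRoot n := by
      rw [s, if_pos rfl, mul_apply, translation_apply, refl_apply, highestRoot_norm hn, wall,
        if_pos rfl]
      module
    rw [this, dotProduct_smul, smul_dotProduct, highestRoot_norm hn, smul_eq_mul, smul_eq_mul]
    ring
  · have : s n j x - x = -wall n j x • simpleRoot n j := by
      rw [s, if_neg (by omega), refl_apply, simpleRoot_norm hn hj hjn, wall, if_neg (by omega)]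
      module
    rw [this, dotProduct_smul, smul_dotProduct, simpleRoot_norm hn hj hjn, smul_eq_mul,
      smul_eq_mul]
    ring

theorem wall_basePoint {j : ℕ} (hn : 2 ≤ n) (hjn : j ≤ n) :
    wall n j (basePoint n) = 1 / (2 * n - 2) := by
  have h3 : (2 : ℝ) ≤ n := by exact_mod_cast hn
  have hp : (2 * n - 2 : ℝ) ≠ 0 := by linarith
  unfold wall
  split_ifs with h
  · rw [highestRoot_dot hn, coord_basePoint le_rfl (by omega), coord_basePoint (by omega) hn,
      ← add_div, eq_div_iff hp, sub_mul, div_mul_cancel₀ _ hp]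
    push_cast
    ring
  · rcases hjn.eq_or_lt with rfl | hjn
    · rw [simpleRoot_last_dot hn, coord_basePoint (by omega) (by omega),
        coord_basePoint (by omega) le_rfl, Nat.cast_sub (by omega)]
      field_simp
      push_cast
      ring
    · rw [simpleRoot_dot (by omega) hjn, coord_basePoint (by omega) (by omega),
        coord_basePoint (by omega) (by omega)]
      field_simp
      push_cast
      ring

/-- The wall functions, weighted by the marks of the affine diagram, add up to the constant 1. So
none can be smaller than at the base point unless another one is larger. -/
theorem eq_basePoint_of_wall_le (hn : 4 ≤ n) {y : Fin n → ℝ}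
    (h : ∀ j ≤ n, wall n j y ≤ 1 / (2 * n - 2)) : y = basePoint n := by
  obtain ⟨z, hz⟩ : ∃ z : ℕ → ℝ, ∀ k, z k = coord y k - coord (basePoint n) k := ⟨_, fun _ => rfl⟩
  have h0 : 0 ≤ z 1 + z 2 := by
    have h1 := h 0 (by omega)
    rw [← wall_basePoint (show 2 ≤ n by omega) (show 0 ≤ n by omega)] at h1
    simp only [wall, if_true, highestRoot_dot (show 2 ≤ n by omega)] at h1
    rw [hz, hz]; linarith
  have hl : z (n - 1) + z n ≤ 0 := by
    have h1 := h n le_rfl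
    rw [← wall_basePoint (show 2 ≤ n by omega) le_rfl] at h1
    simp only [wall, if_neg (show n ≠ 0 by omega), simpleRoot_last_dot (show 2 ≤ n by omega)] at h1
    rw [hz, hz]; linarith
  have hs : ∀ j, 1 ≤ j → j < n → z j ≤ z (j + 1) := fun j hj hjn => by
    have h1 := h j hjn.le
    rw [← wall_basePoint (show 2 ≤ n by omega) hjn.le] at h1
    simp only [wall, if_neg (show j ≠ 0 by omega), simpleRoot_dot hj hjn] at h1
    rw [hz, hz]; linarith
  have hm : ∀ a b, 1 ≤ a → a ≤ b → b ≤ n → z a ≤ z b := fun a b ha hab => by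
    induction b, hab using Nat.le_induction with
    | base => intro; exact le_rfl
    | succ b hab ih => intro hb; exact (ih (by omega)).trans (hs b (by omega) (by omega))
  -- The differences increase, with $0\le z_1+z_2$ and $z_{n-1}+z_n\le 0$. Since $z_1+z_2\le
  -- z_{n-1}+z_n$, both sums vanish; then $0\le z_2\le z_{n-1}\le 0$, and all $z_k$ vanish.
  refine coord_ext fun k hk hkn => ?_
  have e1 := hm 1 2 (by omega) (by omega) (by omega)
  have e2 := hm 2 (n - 1) (by omega) (by omega) (by omega)
  have e3 := hm (n - 1) n (by omega) (by omega) (by omega)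
  have e4 := hm 1 k (by omega) (by omega) (by omega)
  have e5 := hm k n (by omega) (by omega) (by omega)
  have e6 := hz k
  linarith

/-- The affine transformations that preserve the scalar product. -/
def isometryGroup (n : ℕ) : Subgroup (AffineGroup n) where
  carrier := {g | ∀ x y, (g x - g y) ⬝ᵥ (g x - g y) = (x - y) ⬝ᵥ (x - y)}
  mul_mem' {g h} hg hh x y := (hg _ _).trans (hh _ _)
  one_mem' _ _ := rfl
  inv_mem' {g} hg x y := by
    have := hg (g⁻¹ x) (g⁻¹ y)
    rw [← mul_apply, ← mul_apply, mul_inv_cancel] at this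
    exact this.symm

theorem refl_mem_isometryGroup (v : Fin n → ℝ) : refl n v ∈ isometryGroup n := by
  intro x y
  have h : refl n v x - refl n v y = (x - y) - (2 * (v ⬝ᵥ (x - y)) / (v ⬝ᵥ v)) • v := by
    rw [refl_apply, refl_apply, dotProduct_sub]
    module
  rw [h]
  by_cases hv : v ⬝ᵥ v = 0
  · simp [hv]
  · generalize x - y = z
    simp only [dotProduct_sub, sub_dotProduct, dotProduct_smul, smul_dotProduct, smul_eq_mul,
      dotProduct_comm z v]
    field_simp
    ring

theorem extAffineWeyl_le_isometryGroup : extAffineWeyl n ≤ isometryGroup n := by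
  refine sup_le ((Subgroup.closure_le _).2 ?_) ((Subgroup.closure_le _).2 ?_)
  · rintro _ ⟨j, hj, rfl⟩
    rw [s, if_neg (by have := hj.1; omega)]
    exact refl_mem_isometryGroup _
  · rintro _ ⟨v, -, rfl⟩ x y
    simp [translation_apply]

/-- If $\lambda^{-1}s_j\lambda=s_k$, then $s_j$ displaces the image of the base point as far as
$s_k$ displaces the base point itself. So every wall value at the image has absolute value $1/h$,
and the upper bound suffices. -/
theorem diagramGroup_apply_basePoint (hn : 4 ≤ n) {lam : AffineGroup n}
    (h : lam ∈ diagramGroup n) : lam (basePoint n) = basePoint n := by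
  refine eq_basePoint_of_wall_le hn fun j hj => ?_
  obtain ⟨k, hk, ek⟩ : lam⁻¹ * s n j * lam ∈ simpleReflections n := by
    have := (Subgroup.mem_set_normalizer_iff.1 (inv_mem (Subgroup.mem_inf.1 h).2) (s n j)).1
      ⟨j, ⟨by simp, hj⟩, rfl⟩
    simpa using this
  have h1 := extAffineWeyl_le_isometryGroup h.1 (s n k (basePoint n)) (basePoint n)
  have h2 : lam (s n k (basePoint n)) = s n j (lam (basePoint n)) := by
    rw [← mul_apply, ek, ← mul_apply]; congr 1; group
  rw [h2, s_sub_self_norm (by omega) hj, s_sub_self_norm (by omega) hk.2,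
    wall_basePoint (by omega) hk.2] at h1
  have h3 : (2 : ℝ) ≤ n := by exact_mod_cast (show 2 ≤ n by omega)
  have hp : 0 ≤ 1 / (2 * n - 2 : ℝ) := by apply div_nonneg <;> linarith
  exact (abs_le_of_sq_le_sq' (by linarith) hp).2

/-! ### Reduced expressions of translations -/

/-- The reversed word equals $t_{-v}\lambda$. Since $\lambda$ fixes the base point, it carries the
base point to its translate by $-v$, and each letter crosses at most one hyperplane net. -/
theorem sep_le_of_expression (hn : 4 ≤ n) {v : Fin n → ℝ} {lam : AffineGroup n} {L : List ℕ}
    (hlam : lam ∈ diagramGroup n) (hL : ∀ j ∈ L, j ≤ n)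
    (h : translation n v = lam * wordProd n L) : sep (basePoint n - v) ≤ L.length := by
  have h1 : wordProd n L.reverse = (translation n v)⁻¹ * lam := by
    rw [h, mul_inv_rev, mul_assoc, inv_mul_cancel, mul_one]
    exact eq_inv_of_mul_eq_one_left (wordProd_reverse_mul (by omega) L)
  have h2 : basePoint n - v = wordProd n L.reverse (basePoint n) := by
    apply (translation n v).injective
    rw [h1, mul_apply, diagramGroup_apply_basePoint hn hlam, ← mul_apply, mul_inv_cancel,
      translation_apply]
    simp
  rw [h2]
  have := sep_wordProd_le (show 2 ≤ n by omega) (L := L.reverse) (by simpa using hL)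
    (generic_basePoint (n := n))
  simpa [sep_basePoint] using this

theorem isReducedExpression_translation (hn : 4 ≤ n) {v : Fin n → ℝ} {lam : AffineGroup n}
    {L : List ℕ} (hlam : lam ∈ diagramGroup n) (hL : ∀ j ∈ L, j ≤ n)
    (h : translation n v = lam * wordProd n L) (hlen : (L.length : ℝ) = sep (basePoint n - v)) :
    IsReducedExpression n (translation n v) lam L := by
  refine ⟨hlam, hL, h, ?_⟩
  -- The given expression makes the set nonempty, so the infimum is attained and is not the default
  -- value 0.
  have hmem : L.length ∈ {r | ∃ lam ∈ diagramGroup n, ∃ L : List ℕ,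
      (∀ j ∈ L, j ≤ n) ∧ L.length = r ∧ translation n v = lam * wordProd n L} :=
    ⟨lam, hlam, L, hL, rfl, h⟩
  refine le_antisymm ?_ (Nat.sInf_le hmem)
  obtain ⟨lam', hlam', L', hL', e, h'⟩ := Nat.sInf_mem ⟨_, hmem⟩
  have := sep_le_of_expression hn hlam' hL' h'
  have h2 : (L.length : ℤ) = sep (basePoint n - v) := by exact_mod_cast hlen
  unfold extLength
  omega

/-! ### Signed permutations with an even number of signs -/

/-- A signed permutation of the coordinates with an even number of signs. -/
def EvenSigned (g : AffineGroup n) : Prop :=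
  ∃ (σ : Equiv.Perm (Fin n)) (ε : Fin n → ℝ), (∀ a, ε a = 1 ∨ ε a = -1) ∧ ∏ a, ε a = 1 ∧
    ∀ x a, g x a = ε a * x (σ a)

theorem EvenSigned.one : EvenSigned (1 : AffineGroup n) :=
  ⟨1, fun _ => 1, fun _ => Or.inl rfl, by simp, fun x a => by simp⟩

theorem EvenSigned.mul {g h : AffineGroup n} (hg : EvenSigned g) (hh : EvenSigned h) :
    EvenSigned (g * h) := by
  obtain ⟨σ, ε, h1, h2, h3⟩ := hg
  obtain ⟨τ, δ, k1, k2, k3⟩ := hh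
  refine ⟨τ * σ, fun a => ε a * δ (σ a), fun a => ?_, ?_, fun x a => ?_⟩
  · rcases h1 a with h | h <;> rcases k1 (σ a) with k | k <;> simp [h, k]
  · rw [Finset.prod_mul_distrib, h2, Equiv.prod_comp σ δ, k2, one_mul]
  · rw [mul_apply, h3, k3, mul_assoc]; rfl

theorem EvenSigned.map_add_smul {g : AffineGroup n} (hg : EvenSigned g) (x y : Fin n → ℝ)
    (c : ℝ) : g (x + c • y) = g x + c • g y := by
  obtain ⟨σ, ε, -, -, h⟩ := hg
  ext a
  simp only [h, Pi.add_apply, Pi.smul_apply, smul_eq_mul]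
  ring

/-- The linear map `x ↦ (ε_1 x_{τ(1)}, …, ε_n x_{τ(n)})`. -/
def signedLin (n : ℕ) (τ : ℕ → ℕ) (ε : ℕ → ℝ) : (Fin n → ℝ) →ₗ[ℝ] (Fin n → ℝ) where
  toFun x a := ε (a + 1) * coord x (τ (a + 1))
  map_add' x y := by ext a; simp [coord_add, mul_add]
  map_smul' c x := by ext a; simp [coord_smul]; ring

theorem coord_signedLin (τ : ℕ → ℕ) (ε : ℕ → ℝ) (x : Fin n → ℝ) {k : ℕ} (h1 : 1 ≤ k)
    (h2 : k ≤ n) : coord (signedLin n τ ε x) k = ε k * coord x (τ k) :=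
  coord_of_fun (fun k => ε k * coord x (τ k)) h1 h2

/-- The data `τ`, `ε` define an involutive signed permutation with an even number of signs. -/
structure SignedInvolution (n : ℕ) (τ : ℕ → ℕ) (ε : ℕ → ℝ) : Prop where
  mem : ∀ k, 1 ≤ k → k ≤ n → 1 ≤ τ k ∧ τ k ≤ n
  invol : ∀ k, 1 ≤ k → k ≤ n → τ (τ k) = k
  sign : ∀ k, 1 ≤ k → k ≤ n → ε k = 1 ∨ ε k = -1
  sign_invol : ∀ k, 1 ≤ k → k ≤ n → ε (τ k) = ε k
  even : ∏ a : Fin n, ε (a + 1) = 1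

theorem SignedInvolution.involutive {τ : ℕ → ℕ} {ε : ℕ → ℝ} (h : SignedInvolution n τ ε) :
    Function.Involutive (signedLin n τ ε) := by
  intro x
  refine coord_ext fun k h1 h2 => ?_
  rw [coord_signedLin _ _ _ h1 h2, coord_signedLin _ _ _ (h.mem k h1 h2).1 (h.mem k h1 h2).2,
    h.invol k h1 h2, h.sign_invol k h1 h2]
  rcases h.sign k h1 h2 with e | e <;> simp [e]

/-- An involutive signed permutation as an affine transformation. -/
def SignedInvolution.map {τ : ℕ → ℕ} {ε : ℕ → ℝ} (h : SignedInvolution n τ ε) : AffineGroup n :=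
  (LinearEquiv.ofInvolutive (signedLin n τ ε) h.involutive).toAffineEquiv

theorem SignedInvolution.coord_map {τ : ℕ → ℕ} {ε : ℕ → ℝ} (h : SignedInvolution n τ ε)
    (x : Fin n → ℝ) {k : ℕ} (h1 : 1 ≤ k) (h2 : k ≤ n) :
    coord (h.map x) k = ε k * coord x (τ k) :=
  coord_signedLin τ ε x h1 h2

theorem SignedInvolution.map_mul_self {τ : ℕ → ℕ} {ε : ℕ → ℝ} (h : SignedInvolution n τ ε) :
    h.map * h.map = 1 := by
  ext1 x; exact h.involutive x

theorem SignedInvolution.evenSigned_of_coord {τ : ℕ → ℕ} {ε : ℕ → ℝ}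
    (h : SignedInvolution n τ ε) {g : AffineGroup n}
    (hg : ∀ x k, 1 ≤ k → k ≤ n → coord (g x) k = ε k * coord x (τ k)) : EvenSigned g := by
  have hm : ∀ a : Fin n, 1 ≤ τ (a + 1) ∧ τ (a + 1) ≤ n := fun a =>
    h.mem (a + 1) (by omega) (by omega)
  have hi : Function.Involutive
      (fun a : Fin n => (⟨τ (a + 1) - 1, by have := hm a; omega⟩ : Fin n)) := by
    intro a
    ext
    have := h.invol (a + 1) (by omega) (by omega)
    simp only [Nat.sub_add_cancel (hm a).1, this, Nat.add_sub_cancel]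
  refine ⟨hi.toPerm, fun a => ε (a + 1), fun a => h.sign _ (by omega) (by omega), h.even,
    fun x a => ?_⟩
  rw [apply_eq_coord (g x), hg x _ (by omega) (by omega)]
  congr 1
  rw [Function.Involutive.coe_toPerm, apply_eq_coord x]
  congr 1
  have := (hm a).1
  simp only
  omega

theorem SignedInvolution.evenSigned_map {τ : ℕ → ℕ} {ε : ℕ → ℝ} (h : SignedInvolution n τ ε) :
    EvenSigned h.map :=
  h.evenSigned_of_coord fun x _ h1 h2 => h.coord_map x h1 h2

theorem prod_eq_one_of_pair {p q : ℕ} (hp : p < n) (hq : q < n) (hpq : p ≠ q) {ε : ℕ → ℝ}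
    (h : ∀ k, k ≠ p + 1 → k ≠ q + 1 → ε k = 1) (hpq' : ε (p + 1) * ε (q + 1) = 1) :
    ∏ a : Fin n, ε (a + 1) = 1 := by
  rw [← Finset.prod_subset (Finset.subset_univ {⟨p, hp⟩, ⟨q, hq⟩}), Finset.prod_pair, hpq']
  · simpa using hpq
  · intro a _ ha
    simp only [Finset.mem_insert, Finset.mem_singleton, Fin.ext_iff, not_or] at ha
    exact h _ (by omega) (by omega)

theorem evenSigned_s {j : ℕ} (hn : 2 ≤ n) (hj : 1 ≤ j) (hjn : j ≤ n) : EvenSigned (s n j) := by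
  rcases hjn.eq_or_lt with rfl | hjn
  · refine SignedInvolution.evenSigned_of_coord (τ := adjSwap (j - 1))
      (ε := fun k => if k = j - 1 ∨ k = j then -1 else 1) ⟨?_, ?_, ?_, ?_, ?_⟩ ?_
    · grind [adjSwap]
    · grind [adjSwap]
    · grind
    · grind [adjSwap]
    · refine prod_eq_one_of_pair (n := j) (ε := fun k => if k = j - 1 ∨ k = j then -1 else 1)
        (p := j - 2) (q := j - 1) (by omega) (by omega) (by omega) ?_ ?_
      · grind
      · rw [if_pos (by omega), if_pos (by omega)]; norm_num
    · intro x k h1 h2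
      rw [coord_s_last hn]
      grind [adjSwap]
  · refine SignedInvolution.evenSigned_of_coord (τ := adjSwap j)
      (ε := fun k => 1) ⟨?_, ?_, ?_, ?_, ?_⟩ ?_
    · grind [adjSwap]
    · grind [adjSwap]
    · grind
    · grind [adjSwap]
    · simp
    · intro x k h1 h2
      rw [coord_s hj hjn]
      grind [adjSwap]

/-! ### Uniqueness of the dominant representative -/

/-- Strict dominance: positivity on all simple roots. -/
def Dominant (x : Fin n → ℝ) : Prop := ∀ j, 1 ≤ j → j ≤ n → 0 < simpleRoot n j ⬝ᵥ x

theorem Dominant.abs_lt (hn : 2 ≤ n) {x : Fin n → ℝ} (hx : Dominant x) {a b : Fin n}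
    (hab : a < b) : |x b| < x a := by
  have hs : ∀ j, 1 ≤ j → j < n → coord x (j + 1) < coord x j := fun j h1 h2 => by
    have := hx j h1 h2.le
    rw [simpleRoot_dot h1 h2] at this
    linarith
  have hl : 0 < coord x (n - 1) + coord x n := by
    have := hx n (by omega) le_rfl
    rwa [simpleRoot_last_dot hn] at this
  have hl' : coord x n < coord x (n - 1) := by
    have := hs (n - 1) (by omega) (by omega)
    rwa [show n - 1 + 1 = n by omega] at this
  have hm : ∀ a b, 1 ≤ a → a ≤ b → b ≤ n → coord x b ≤ coord x a := fun a b ha hab => by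
    induction b, hab using Nat.le_induction with
    | base => intro; exact le_rfl
    | succ b hab ih => intro hb; exact (hs b (by omega) (by omega)).le.trans (ih (by omega))
  have hab' : (a : ℕ) < b := hab
  have hb := b.2
  rw [apply_eq_coord x a, apply_eq_coord x b, _root_.abs_lt]
  have h1 := hs (a + 1) (by omega) (by omega)
  have h2 := hm (a + 1 + 1) (b + 1) (by omega) (by omega) (by omega)
  have h3 := hm (b + 1) n (by omega) (by omega) le_rfl
  have h4 := hm (a + 1) (n - 1) (by omega) (by omega) (by omega)
  constructor <;> linarith

/-- Strict dominance means $x_1>\dots>x_{n-1}>|x_n|$. The absolute values decrease strictly before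
and after, so the permutation is trivial; all coordinates but the last are positive, so their signs
are trivial; the even number of signs settles the last one. -/
theorem EvenSigned.eq_one_of_dominant (hn : 2 ≤ n) {g : AffineGroup n} (hg : EvenSigned g)
    {x : Fin n → ℝ} (hx : Dominant x) (hgx : Dominant (g x)) : g = 1 := by
  obtain ⟨σ, ε, h1, h2, h3⟩ := hg
  have hanti : ∀ {y : Fin n → ℝ}, Dominant y → StrictAnti fun a => |y a| := fun hy a b hab =>
    (hy.abs_lt hn hab).trans_le (le_abs_self _)
  have habs : ∀ a, |g x a| = |x (σ a)| := fun a => by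
    rw [h3, abs_mul]
    rcases h1 a with h | h <;> simp [h]
  have hmono : StrictMono σ := fun a b hab => by
    have := hanti hgx hab
    simp only [habs] at this
    exact (hanti hx).lt_iff_gt.1 this
  have hσ : (σ : Fin n → Fin n) = id := (hmono.range_inj strictMono_id).1 (by simp)
  have hε : ∀ a : Fin n, (a : ℕ) ≠ n - 1 → ε a = 1 := fun a ha => by
    have hab : a < ⟨n - 1, by omega⟩ := by
      rw [Fin.lt_def]; simp only; omega
    have p1 := (abs_nonneg _).trans_lt (hx.abs_lt hn hab)
    have p2 := (abs_nonneg _).trans_lt (hgx.abs_lt hn hab)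
    rw [h3, hσ, id] at p2
    rcases h1 a with h | h
    · exact h
    · rw [h] at p2; linarith
  have hl : ε ⟨n - 1, by omega⟩ = 1 := by
    rw [← h2, Finset.prod_eq_single ⟨n - 1, by omega⟩]
    · intro b _ hb
      exact hε b fun h => hb (Fin.ext h)
    · simp
  ext x a
  have : ε a = 1 := by
    by_cases h : (a : ℕ) = n - 1
    · rw [show a = ⟨n - 1, by omega⟩ from Fin.ext h, hl]
    · exact hε a h
  rw [h3, this, hσ]
  simp

/-! ### Longest elements of maximal parabolic subgroups -/

theorem mem_closure_iff_exists_word (hn : 2 ≤ n) {I : Set ℕ} {w : AffineGroup n} :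
    w ∈ Subgroup.closure (s n '' I) ↔ ∃ L : List ℕ, (∀ j ∈ L, j ∈ I) ∧ w = wordProd n L := by
  constructor
  · intro h
    induction h using Subgroup.closure_induction with
    | mem x hx =>
      obtain ⟨j, hj, rfl⟩ := hx
      exact ⟨[j], by simpa using hj, (wordProd_singleton j).symm⟩
    | one => exact ⟨[], by simp, rfl⟩
    | mul x y _ _ hx hy =>
      obtain ⟨L, hL, rfl⟩ := hx
      obtain ⟨M, hM, rfl⟩ := hy
      exact ⟨L ++ M, by grind, (wordProd_append L M).symm⟩
    | inv x _ hx =>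
      obtain ⟨L, hL, rfl⟩ := hx
      exact ⟨L.reverse, by simpa using hL,
        (eq_inv_of_mul_eq_one_left (wordProd_reverse_mul hn L)).symm⟩
  · rintro ⟨L, hL, rfl⟩
    refine Subgroup.list_prod_mem _ fun x hx => ?_
    obtain ⟨j, hj, rfl⟩ := List.mem_map.1 hx
    exact Subgroup.subset_closure ⟨j, hL j hj, rfl⟩

theorem s_apply_of_dot_eq_zero {i : ℕ} (hi : 1 ≤ i) {x : Fin n → ℝ}
    (h : simpleRoot n i ⬝ᵥ x = 0) : s n i x = x := by
  rw [s, if_neg (by omega), refl_apply, h]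
  simp

variable {j : ℕ}

/-- Here and below `j = 0` is allowed. It removes no node, and `fundamentalWeight n 0` is the empty
sum 0, so $W_0$ itself is treated together with its maximal parabolic subgroups. -/
theorem evenSigned_of_mem_closure (hn : 2 ≤ n) {w : AffineGroup n}
    (hw : w ∈ Subgroup.closure (s n '' (Set.Icc 1 n \ {j}))) : EvenSigned w := by
  obtain ⟨L, hL, rfl⟩ := (mem_closure_iff_exists_word hn).1 hw
  clear hw
  induction L with
  | nil => exact .one
  | cons i L ih =>
    rw [wordProd_cons]
    have hi := (hL i (by simp)).1
    exact (evenSigned_s hn hi.1 hi.2).mul (ih fun k hk => hL k (by simp [hk]))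

theorem apply_fundamentalWeight_of_mem_closure (hn : 4 ≤ n) (hj : j ≤ n) {w : AffineGroup n}
    (hw : w ∈ Subgroup.closure (s n '' (Set.Icc 1 n \ {j}))) :
    w (fundamentalWeight n j) = fundamentalWeight n j := by
  obtain ⟨L, hL, rfl⟩ := (mem_closure_iff_exists_word (by omega)).1 hw
  clear hw
  induction L with
  | nil => rfl
  | cons i L ih =>
    obtain ⟨hi, hij⟩ := hL i (by simp)
    rw [wordProd_cons, mul_apply, ih fun k hk => hL k (by simp [hk])]
    apply s_apply_of_dot_eq_zero hi.1
    rw [simpleRoot_dot_fundamentalWeight n j i hn hj hi.1 hi.2, if_neg]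
    exact fun h => hij h.symm

theorem generic_apply_of_mem_closure (hn : 2 ≤ n) {w : AffineGroup n}
    (hw : w ∈ Subgroup.closure (s n '' (Set.Icc 1 n \ {j}))) : Generic (w (basePoint n)) := by
  obtain ⟨L, hL, rfl⟩ := (mem_closure_iff_exists_word hn).1 hw
  exact generic_wordProd hn (fun k hk => (hL k hk).1.2) generic_basePoint

theorem simpleRoot_dot_basePoint_pos (hn : 2 ≤ n) {i : ℕ} (hi : 1 ≤ i) (hin : i ≤ n) :
    0 < simpleRoot n i ⬝ᵥ basePoint n := by
  have := wall_basePoint hn hin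
  rw [wall, if_neg (by omega)] at this
  rw [this]
  have h3 : (2 : ℝ) ≤ n := by exact_mod_cast hn
  apply div_pos <;> linarith

/-- Moving the base point far in the direction $\omega_j$, which `u` fixes, makes the one
uncontrolled root $\alpha_j$ positive on the image as well. This reduces the parabolic case to full
dominance. -/
theorem EvenSigned.eq_one (hn : 4 ≤ n) (hj : j ≤ n) {u : AffineGroup n} (hu : EvenSigned u)
    (hw : u (fundamentalWeight n j) = fundamentalWeight n j)
    (hpos : ∀ i ∈ Set.Icc 1 n \ {j}, 0 < simpleRoot n i ⬝ᵥ u (basePoint n)) : u = 1 := by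
  -- Large enough to outweigh the value of $\alpha_j$ at the image of the base point.
  obtain ⟨M, hM⟩ : ∃ M, M = 1 + |simpleRoot n j ⬝ᵥ u (basePoint n)| := ⟨_, rfl⟩
  have hM0 : 0 < M := by rw [hM]; positivity
  refine hu.eq_one_of_dominant (by omega) (x := basePoint n + M • fundamentalWeight n j)
    (fun i hi hin => ?_) (fun i hi hin => ?_)
  · have := simpleRoot_dot_basePoint_pos (show 2 ≤ n by omega) hi hin
    rw [dotProduct_add, dotProduct_smul, simpleRoot_dot_fundamentalWeight n j i hn hj hi hin,
      smul_eq_mul]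
    split_ifs <;> linarith
  · rw [hu.map_add_smul, hw, dotProduct_add, dotProduct_smul,
      simpleRoot_dot_fundamentalWeight n j i hn hj hi hin, smul_eq_mul]
    split_ifs with h
    · subst h
      have := neg_abs_le (simpleRoot n j ⬝ᵥ u (basePoint n))
      linarith
    · have := hpos i ⟨⟨hi, hin⟩, fun h' => h h'.symm⟩
      linarith

theorem sep_nonneg (x : Fin n → ℝ) : 0 ≤ sep x :=
  Finset.sum_nonneg fun _ _ => add_nonneg (abs_nonneg _) (abs_nonneg _)

/-- Descent on `sep`: unless `w = 1`, some allowed simple root is not positive on the image of the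
base point, and multiplying by its reflection lowers `sep` by 1. -/
theorem exists_word_length_eq_sep (hn : 4 ≤ n) (hj : j ≤ n) {w : AffineGroup n}
    (hw : w ∈ Subgroup.closure (s n '' (Set.Icc 1 n \ {j}))) :
    ∃ L : List ℕ, (∀ i ∈ L, i ∈ Set.Icc 1 n \ {j}) ∧ (L.length : ℤ) = sep (w (basePoint n)) ∧
      w = wordProd n L := by
  obtain ⟨k, hk⟩ := Int.eq_ofNat_of_zero_le (sep_nonneg (w (basePoint n)))
  induction k generalizing w with
  | zero =>
    have h1 : w = 1 := by
      refine (evenSigned_of_mem_closure (by omega) hw).eq_one hn hj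
        (apply_fundamentalWeight_of_mem_closure hn hj hw) fun i hi => ?_
      by_contra hneg
      have := sep_s (show 2 ≤ n by omega) hi.1.1 hi.1.2
        (generic_apply_of_mem_closure (show 2 ≤ n by omega) hw)
      rw [if_neg hneg, hk] at this
      have := sep_nonneg (s n i (w (basePoint n)))
      simp at *
      omega
    subst h1
    exact ⟨[], by simp, by simpa using hk.symm, rfl⟩
  | succ k ih =>
    by_cases h : ∀ i ∈ Set.Icc 1 n \ {j}, 0 < simpleRoot n i ⬝ᵥ w (basePoint n)
    · have h1 : w = 1 := (evenSigned_of_mem_closure (by omega) hw).eq_one hn hj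
        (apply_fundamentalWeight_of_mem_closure hn hj hw) h
      subst h1
      have : sep (basePoint n) = ((k + 1 : ℕ) : ℤ) := hk
      rw [sep_basePoint] at this
      omega
    · push Not at h
      obtain ⟨i, hi, hneg⟩ := h
      have hs := sep_s (show 2 ≤ n by omega) hi.1.1 hi.1.2
        (generic_apply_of_mem_closure (show 2 ≤ n by omega) hw)
      rw [if_neg (not_lt.2 hneg), hk] at hs
      obtain ⟨L, hL, hlen, e⟩ := ih (w := s n i * w)
        (mul_mem (Subgroup.subset_closure (Set.mem_image_of_mem _ hi)) hw) (by
          rw [mul_apply, hs]; push_cast; ring)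
      refine ⟨i :: L, by grind, ?_, ?_⟩
      · rw [mul_apply, hs] at hlen
        rw [hk, List.length_cons]; push_cast at *; linarith
      · rw [wordProd_cons, ← e, ← mul_assoc, mul_self_s (by omega), one_mul]

theorem parabolicLength_eq_sep (hn : 4 ≤ n) (hj : j ≤ n) {w : AffineGroup n}
    (hw : w ∈ Subgroup.closure (s n '' (Set.Icc 1 n \ {j}))) :
    (parabolicLength n (Set.Icc 1 n \ {j}) w : ℤ) = sep (w (basePoint n)) := by
  obtain ⟨L, hL, hlen, e⟩ := exists_word_length_eq_sep hn hj hw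
  have hmem : L.length ∈ {r | ∃ L : List ℕ, (∀ i ∈ L, i ∈ Set.Icc 1 n \ {j}) ∧ L.length = r ∧
      w = wordProd n L} := ⟨L, hL, rfl, e⟩
  apply le_antisymm
  · rw [← hlen]
    exact_mod_cast Nat.sInf_le hmem
  · obtain ⟨L', hL', e1, e2⟩ := Nat.sInf_mem ⟨_, hmem⟩
    have h1 := sep_wordProd_le (show 2 ≤ n by omega) (fun k hk => (hL' k hk).1.2)
      (generic_basePoint (n := n))
    rw [sep_basePoint, zero_add, ← e2, e1] at h1
    exact h1

theorem abs_basePoint_le (hn : 2 ≤ n) (a : Fin n) : |basePoint n a| ≤ 1 := by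
  have h1 : (2 : ℝ) ≤ n := by exact_mod_cast hn
  have h2 : ((a : ℝ) + 1) ≤ n := by exact_mod_cast (show (a : ℕ) + 1 ≤ n by omega)
  have h3 : (0 : ℝ) ≤ a := by positivity
  have hp : (0 : ℝ) < 2 * n - 2 := by linarith
  unfold basePoint
  rw [abs_le, le_div_iff₀ hp, div_le_iff₀ hp]
  push_cast
  constructor <;> linarith

/-- A crude bound, in place of the finiteness of the group: it bounds the Coxeter lengths, so that
an element of maximal length exists. -/
theorem sep_le_of_evenSigned (hn : 2 ≤ n) {g : AffineGroup n} (hg : EvenSigned g) :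
    sep (g (basePoint n)) ≤ (indexPairs n).card • 4 := by
  obtain ⟨σ, ε, h1, -, h3⟩ := hg
  have h : ∀ k, |coord (g (basePoint n)) k| ≤ 1 := fun k => by
    unfold coord
    split_ifs
    · rw [h3, abs_mul]
      have := abs_basePoint_le hn (σ ⟨k - 1, by omega⟩)
      rcases h1 ⟨k - 1, by omega⟩ with e | e <;> simpa [e] using this
    · simp
  refine Finset.sum_le_card_nsmul _ _ _ fun q _ => ?_
  obtain ⟨a1, a2⟩ := abs_le.1 (h q.1)
  obtain ⟨b1, b2⟩ := abs_le.1 (h q.2)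
  have hf : ∀ t : ℝ, -2 ≤ t → t ≤ 2 → |⌊t⌋| ≤ 2 := fun t h1 h2 => by
    rw [abs_le]
    constructor
    · exact Int.le_floor.2 (by push_cast; linarith)
    · exact_mod_cast (Int.floor_le t).trans h2
  have e1 := hf (coord (g (basePoint n)) q.1 - coord (g (basePoint n)) q.2)
    (by linarith) (by linarith)
  have e2 := hf (coord (g (basePoint n)) q.1 + coord (g (basePoint n)) q.2)
    (by linarith) (by linarith)
  unfold pairSep
  linarith

theorem isLongest_longest (hn : 4 ≤ n) (hj : j ≤ n) :
    IsLongest n (Set.Icc 1 n \ {j}) (longest n (Set.Icc 1 n \ {j})) := by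
  -- The choice operator says nothing until some longest element is exhibited; it comes from the
  -- maximum of a bounded nonempty set of lengths.
  apply Classical.epsilon_spec (p := IsLongest n (Set.Icc 1 n \ {j}))
  let S : Set ℕ := parabolicLength n (Set.Icc 1 n \ {j}) ''
    (Subgroup.closure (s n '' (Set.Icc 1 n \ {j})) : Set (AffineGroup n))
  have hb : BddAbove S := by
    refine ⟨(indexPairs n).card • 4, ?_⟩
    rintro _ ⟨w, hw, rfl⟩
    have h1 := parabolicLength_eq_sep hn hj hw
    have h2 := sep_le_of_evenSigned (show 2 ≤ n by omega)
      (evenSigned_of_mem_closure (show 2 ≤ n by omega) hw)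
    rw [← h1] at h2
    simp only [smul_eq_mul, nsmul_eq_mul] at *
    exact_mod_cast h2
  obtain ⟨w, hw, e⟩ := Nat.sSup_mem (s := S) ⟨_, 1, one_mem _, rfl⟩ hb
  refine ⟨w, hw, fun u hu => ?_⟩
  rw [e]
  exact le_csSup hb ⟨u, hu, rfl⟩

/-- A positive value would let $s_i$ lengthen the element, and zero is excluded by genericity. -/
theorem simpleRoot_dot_longest_neg (hn : 4 ≤ n) (hj : j ≤ n) {i : ℕ}
    (hi : i ∈ Set.Icc 1 n \ {j}) :
    simpleRoot n i ⬝ᵥ longest n (Set.Icc 1 n \ {j}) (basePoint n) < 0 := by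
  obtain ⟨hw, hmax⟩ := isLongest_longest hn hj
  generalize longest n (Set.Icc 1 n \ {j}) = w at hw hmax
  have hg := generic_apply_of_mem_closure (show 2 ≤ n by omega) hw
  have hnot : ¬ 0 < simpleRoot n i ⬝ᵥ w (basePoint n) := by
    intro hpos
    have hs := sep_s (show 2 ≤ n by omega) hi.1.1 hi.1.2 hg
    rw [if_pos hpos] at hs
    have hm := mul_mem (Subgroup.subset_closure (Set.mem_image_of_mem _ hi)) hw
    have h1 := parabolicLength_eq_sep hn hj hw
    have h2 := parabolicLength_eq_sep hn hj hm
    have h3 := hmax _ hm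
    rw [mul_apply, hs, ← h1] at h2
    omega
  refine lt_of_le_of_ne (not_lt.1 hnot) ?_
  rcases hi.1.2.eq_or_lt with rfl | hin
  · rw [simpleRoot_last_dot (by omega)]
    simpa using (hg (i - 1) i (by omega) (by omega) (by omega) (by omega) (by omega)).2 0
  · rw [simpleRoot_dot hi.1.1 hin]
    simpa using (hg i (i + 1) hi.1.1 hi.1.2 (by omega) (by omega) (by omega)).1 0

/-- An involution in the stabilizer of `ω_j` that maps the simple roots other than `α_j` to their
negatives, up to a permutation, is the longest element. -/
theorem SignedInvolution.map_eq_longest {τ : ℕ → ℕ} {ε : ℕ → ℝ} (h : SignedInvolution n τ ε)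
    (hn : 4 ≤ n) (hj : j ≤ n)
    (hfix : h.map (fundamentalWeight n j) = fundamentalWeight n j)
    (hneg : ∀ i ∈ Set.Icc 1 n \ {j}, ∃ i' ∈ Set.Icc 1 n \ {j}, ∀ x,
      simpleRoot n i ⬝ᵥ h.map x = -(simpleRoot n i' ⬝ᵥ x)) :
    longest n (Set.Icc 1 n \ {j}) = h.map := by
  have hw := (isLongest_longest hn hj).1
  -- The longest element makes the allowed simple roots negative and `h.map` reverses their signs
  -- once more, so the product satisfies the uniqueness criterion.
  have h1 : h.map * longest n (Set.Icc 1 n \ {j}) = 1 := by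
    refine (h.evenSigned_map.mul (evenSigned_of_mem_closure (by omega) hw)).eq_one hn hj ?_ ?_
    · rw [mul_apply, apply_fundamentalWeight_of_mem_closure hn hj hw, hfix]
    · intro i hi
      obtain ⟨i', hi', e⟩ := hneg i hi
      rw [mul_apply, e]
      have := simpleRoot_dot_longest_neg hn hj hi'
      linarith
  calc _ = h.map * (h.map * longest n (Set.Icc 1 n \ {j})) := by
        rw [← mul_assoc, h.map_mul_self, one_mul]
    _ = h.map := by rw [h1, mul_one]

/-! ### The longest elements and the elements `π_j` in coordinates -/

/-- This is $-1$ when $n$ is even. When $n$ is odd the last coordinate keeps its sign to make the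
number of signs even, and $\alpha_{n-1}$, $\alpha_n$ are exchanged up to sign. -/
theorem coord_longest (hn : 4 ≤ n) (x : Fin n → ℝ) {k : ℕ} (h1 : 1 ≤ k) (h2 : k ≤ n) :
    coord (longest n (Set.Icc 1 n) x) k = (if k = n then (-1) ^ (n + 1) else -1) * coord x k := by
  have hS : SignedInvolution n id (fun k => if k = n then (-1) ^ (n + 1) else -1) := by
    refine ⟨fun _ h1 h2 => ⟨h1, h2⟩, by simp, fun k _ _ => ?_, by simp, ?_⟩
    · have := neg_one_pow_eq_or ℝ (n + 1)
      split_ifs <;> simp [this]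
    · obtain ⟨m, rfl⟩ : ∃ m, n = m + 1 := ⟨n - 1, by omega⟩
      rw [Fin.prod_univ_castSucc]
      have : ∀ a : Fin m, (a : ℕ) + 1 ≠ m + 1 := fun a => by omega
      simp only [Fin.val_castSucc, this, if_false, Fin.val_last, if_true, Finset.prod_const,
        Finset.card_univ, Fintype.card_fin]
      rw [← pow_add, show m + (m + 1 + 1) = 2 * (m + 1) by ring]
      simp
  have e : Set.Icc 1 n \ {0} = Set.Icc 1 n := Set.sdiff_singleton_eq_self (by simp)
  have hl := hS.map_eq_longest hn (j := 0) (by omega) ?_ ?_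
  · rw [e] at hl
    rw [hl, hS.coord_map x h1 h2, id]
  · refine coord_ext fun k h1 h2 => ?_
    rw [hS.coord_map _ h1 h2, id, coord_fundamentalWeight hn h1 h2]
    simp [show 2 ≤ n by omega, show k ≠ 0 by omega]
  · rw [e]
    rintro i ⟨hi, hin⟩
    rcases Nat.even_or_odd n with hp | hp
    · have hs : ((-1 : ℝ)) ^ (n + 1) = -1 := hp.add_one.neg_one_pow
      refine ⟨i, ⟨hi, hin⟩, fun x => ?_⟩
      rcases hin.eq_or_lt with rfl | hin
      · rw [simpleRoot_last_dot (by omega), simpleRoot_last_dot (by omega),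
          hS.coord_map _ (by omega) (by omega), hS.coord_map _ (by omega) (by omega)]
        simp only [hs, ite_self, id]
        ring
      · rw [simpleRoot_dot hi hin, simpleRoot_dot hi hin,
          hS.coord_map _ (by omega) (by omega), hS.coord_map _ (by omega) (by omega)]
        simp only [hs, ite_self, id]
        ring
    · have hs : ((-1 : ℝ)) ^ (n + 1) = 1 := hp.add_one.neg_one_pow
      rcases hin.eq_or_lt with rfl | hin
      · refine ⟨i - 1, ⟨by omega, by omega⟩, fun x => ?_⟩
        rw [simpleRoot_last_dot (by omega), simpleRoot_dot (by omega) (by omega),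
          hS.coord_map _ (by omega) (by omega), hS.coord_map _ (by omega) (by omega)]
        simp only [hs, id]
        grind
      · by_cases hin' : i = n - 1
        · subst hin'
          refine ⟨n, ⟨by omega, by omega⟩, fun x => ?_⟩
          rw [simpleRoot_last_dot (by omega), simpleRoot_dot (by omega) (by omega),
            hS.coord_map _ (by omega) (by omega), hS.coord_map _ (by omega) (by omega)]
          simp only [hs, id]
          grind
        · refine ⟨i, ⟨by omega, by omega⟩, fun x => ?_⟩
          rw [simpleRoot_dot (by omega) (by omega), simpleRoot_dot (by omega) (by omega),
            hS.coord_map _ (by omega) (by omega), hS.coord_map _ (by omega) (by omega)]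
          simp only [id]
          grind

/-- The same pattern for the subsystem on the coordinates $2,\dots,n$, which changes the parity of
the exponent. -/
theorem coord_longest_first (hn : 4 ≤ n) (x : Fin n → ℝ) {k : ℕ} (h1 : 1 ≤ k) (h2 : k ≤ n) :
    coord (longest n (Set.Icc 1 n \ {1}) x) k =
      (if k = 1 then 1 else if k = n then (-1) ^ n else -1) * coord x k := by
  have hS : SignedInvolution n id
      (fun k => if k = 1 then 1 else if k = n then (-1) ^ n else -1) := by
    refine ⟨fun _ h1 h2 => ⟨h1, h2⟩, by simp, fun k _ _ => ?_, by simp, ?_⟩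
    · have := neg_one_pow_eq_or ℝ n
      split_ifs <;> simp [this]
    · obtain ⟨m, rfl⟩ : ∃ m, n = m + 2 := ⟨n - 2, by omega⟩
      rw [Fin.prod_univ_succ, Fin.prod_univ_castSucc]
      have : ∀ a : Fin m, (a : ℕ) ≠ m := fun a => by omega
      simp [this, ← pow_add]
      rw [show m + (m + 2) = 2 * (m + 1) by ring]
      simp
  have hl := hS.map_eq_longest hn (j := 1) (by omega) ?_ ?_
  · rw [hl, hS.coord_map x h1 h2, id]
  · refine coord_ext fun k h1 h2 => ?_
    rw [hS.coord_map _ h1 h2, id, coord_fundamentalWeight hn h1 h2]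
    grind
  · rintro i ⟨⟨hi, hin⟩, hi1⟩
    have hi1 : i ≠ 1 := hi1
    rcases Nat.even_or_odd n with hp | hp
    · have hs : ((-1 : ℝ)) ^ n = 1 := hp.neg_one_pow
      rcases hin.eq_or_lt with rfl | hin
      · refine ⟨i - 1, ⟨⟨by omega, by omega⟩, fun h => by simp at h; omega⟩, fun x => ?_⟩
        rw [simpleRoot_last_dot (by omega), simpleRoot_dot (by omega) (by omega),
          hS.coord_map _ (by omega) (by omega), hS.coord_map _ (by omega) (by omega)]
        simp only [hs, id]
        grind
      · by_cases hin' : i = n - 1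
        · subst hin'
          refine ⟨n, ⟨⟨by omega, by omega⟩, fun h => by simp at h; omega⟩, fun x => ?_⟩
          rw [simpleRoot_last_dot (by omega), simpleRoot_dot (by omega) (by omega),
            hS.coord_map _ (by omega) (by omega), hS.coord_map _ (by omega) (by omega)]
          simp only [hs, id]
          grind
        · refine ⟨i, ⟨⟨by omega, by omega⟩, hi1⟩, fun x => ?_⟩
          rw [simpleRoot_dot (by omega) (by omega), simpleRoot_dot (by omega) (by omega),
            hS.coord_map _ (by omega) (by omega), hS.coord_map _ (by omega) (by omega)]
          simp only [id]
          grind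
    · have hs : ((-1 : ℝ)) ^ n = -1 := hp.neg_one_pow
      refine ⟨i, ⟨⟨hi, hin⟩, hi1⟩, fun x => ?_⟩
      rcases hin.eq_or_lt with rfl | hin
      · rw [simpleRoot_last_dot (by omega), simpleRoot_last_dot (by omega),
          hS.coord_map _ (by omega) (by omega), hS.coord_map _ (by omega) (by omega)]
        simp only [hs, id]
        grind
      · rw [simpleRoot_dot hi hin, simpleRoot_dot hi hin,
          hS.coord_map _ (by omega) (by omega), hS.coord_map _ (by omega) (by omega)]
        simp only [hs, id]
        grind

theorem coord_longest_last (hn : 4 ≤ n) (x : Fin n → ℝ) {k : ℕ} (h1 : 1 ≤ k) (h2 : k ≤ n) :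
    coord (longest n (Set.Icc 1 n \ {n}) x) k = coord x (n + 1 - k) := by
  have hS : SignedInvolution n (fun k => n + 1 - k) (fun _ => 1) := by
    refine ⟨?_, ?_, by simp, by simp, by simp⟩ <;> intro k _ _ <;> omega
  have hl := hS.map_eq_longest hn (j := n) (by omega) ?_ ?_
  · rw [hl, hS.coord_map x h1 h2, one_mul]
  · refine coord_ext fun k h1 h2 => ?_
    rw [hS.coord_map _ h1 h2, coord_fundamentalWeight hn h1 h2,
      coord_fundamentalWeight hn (by omega) (by omega)]
    grind
  · rintro i ⟨⟨hi, hin⟩, hi1⟩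
    have hi1 : i ≠ n := hi1
    refine ⟨n - i, ⟨⟨by omega, by omega⟩, fun h => by simp at h; omega⟩, fun x => ?_⟩
    rw [simpleRoot_dot (by omega) (by omega), simpleRoot_dot (by omega) (by omega),
      hS.coord_map _ (by omega) (by omega), hS.coord_map _ (by omega) (by omega)]
    grind

/-- The stabilizer of $\omega_{n-1}$ is the symmetric group conjugated by the sign change of $e_n$;
its longest element is the conjugated reversal, with signs at both ends. -/
theorem coord_longest_penultimate (hn : 4 ≤ n) (x : Fin n → ℝ) {k : ℕ} (h1 : 1 ≤ k)
    (h2 : k ≤ n) :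
    coord (longest n (Set.Icc 1 n \ {n - 1}) x) k =
      (if k = 1 ∨ k = n then -1 else 1) * coord x (n + 1 - k) := by
  have hS : SignedInvolution n (fun k => n + 1 - k) (fun k => if k = 1 ∨ k = n then -1 else 1) := by
    refine ⟨fun k _ _ => ?_, fun k _ _ => ?_, by grind, by grind, ?_⟩
    · omega
    · omega
    · refine prod_eq_one_of_pair (ε := fun k => if k = 1 ∨ k = n then (-1 : ℝ) else 1)
        (p := 0) (q := n - 1) (by omega) (by omega) (by omega) ?_ ?_
      · grind
      · grind
  have hl := hS.map_eq_longest hn (j := n - 1) (by omega) ?_ ?_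
  · rw [hl, hS.coord_map x h1 h2]
  · refine coord_ext fun k h1 h2 => ?_
    rw [hS.coord_map _ h1 h2, coord_fundamentalWeight hn h1 h2,
      coord_fundamentalWeight hn (by omega) (by omega)]
    grind
  · rintro i ⟨⟨hi, hin⟩, hi1⟩
    have hi1 : i ≠ n - 1 := hi1
    rcases hin.eq_or_lt with rfl | hin
    · refine ⟨1, ⟨⟨by omega, by omega⟩, fun h => by simp at h; omega⟩, fun x => ?_⟩
      rw [simpleRoot_last_dot (by omega), simpleRoot_dot (by omega) (by omega),
        hS.coord_map _ (by omega) (by omega), hS.coord_map _ (by omega) (by omega)]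
      grind
    · by_cases h : i = 1
      · subst h
        refine ⟨n, ⟨⟨by omega, by omega⟩, fun h => by simp at h; omega⟩, fun x => ?_⟩
        rw [simpleRoot_last_dot (by omega), simpleRoot_dot (by omega) (by omega),
          hS.coord_map _ (by omega) (by omega), hS.coord_map _ (by omega) (by omega)]
        grind
      · refine ⟨n - i, ⟨⟨by omega, by omega⟩, fun h => by simp at h; omega⟩, fun x => ?_⟩
        rw [simpleRoot_dot (by omega) (by omega), simpleRoot_dot (by omega) (by omega),
          hS.coord_map _ (by omega) (by omega), hS.coord_map _ (by omega) (by omega)]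
        grind

theorem coord_diagramAut_first (hn : 4 ≤ n) (x : Fin n → ℝ) {k : ℕ} (h1 : 1 ≤ k) (h2 : k ≤ n) :
    coord (diagramAut n 1 x) k =
      if k = 1 then 1 - coord x 1 else if k = n then -coord x n else coord x k := by
  rw [diagramAut, mul_apply, mul_apply, coord_translation, coord_longest_first hn _ h1 h2,
    coord_longest hn _ h1 h2, coord_fundamentalWeight hn h1 h2]
  rcases neg_one_pow_eq_or ℝ n with h | h <;> simp only [pow_succ, h] <;> grind

theorem coord_diagramAut_last (hn : 4 ≤ n) (x : Fin n → ℝ) {k : ℕ} (h1 : 1 ≤ k) (h2 : k ≤ n) :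
    coord (diagramAut n n x) k =
      if k = 1 then 1 / 2 + (-1) ^ (n + 1) * coord x n else 1 / 2 - coord x (n + 1 - k) := by
  rw [diagramAut, mul_apply, mul_apply, coord_translation, coord_longest_last hn _ h1 h2,
    coord_longest hn _ (by omega) (by omega), coord_fundamentalWeight hn h1 h2]
  generalize ((-1 : ℝ)) ^ (n + 1) = c
  grind

theorem coord_diagramAut_penultimate (hn : 4 ≤ n) (x : Fin n → ℝ) {k : ℕ} (h1 : 1 ≤ k)
    (h2 : k ≤ n) :
    coord (diagramAut n (n - 1) x) k =
      if k = 1 then 1 / 2 - (-1) ^ (n + 1) * coord x n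
      else if k = n then coord x 1 - 1 / 2 else 1 / 2 - coord x (n + 1 - k) := by
  rw [diagramAut, mul_apply, mul_apply, coord_translation, coord_longest_penultimate hn _ h1 h2,
    coord_longest hn _ (by omega) (by omega), coord_fundamentalWeight hn h1 h2]
  generalize ((-1 : ℝ)) ^ (n + 1) = c
  grind

/-! ### The elements `π_j` belong to `Λ` -/

theorem diagramAut_mem_extAffineWeyl (hn : 4 ≤ n) {j : ℕ} (hj : j ≤ n) :
    diagramAut n j ∈ extAffineWeyl n := by
  have hle : ∀ I ⊆ Set.Icc 1 n, Subgroup.closure (s n '' I) ≤ extAffineWeyl n := fun I hI =>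
    (Subgroup.closure_mono (Set.image_mono hI)).trans le_sup_left
  have h0 : longest n (Set.Icc 1 n) ∈ extAffineWeyl n := by
    have := (isLongest_longest hn (Nat.zero_le n)).1
    rw [Set.sdiff_singleton_eq_self (by simp)] at this
    exact hle _ subset_rfl this
  refine mul_mem (mul_mem ?_ (hle _ Set.sdiff_subset (isLongest_longest hn hj).1)) h0
  refine (le_sup_right : _ ≤ extAffineWeyl n) (Subgroup.subset_closure ⟨_, fun i hi hin => ?_, rfl⟩)
  rw [simpleRoot_dot_fundamentalWeight n j i hn hj hi hin]
  exact ⟨if j = i then 1 else 0, by push_cast; rfl⟩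

/-- Conjugation is injective, and mapping a finite set into itself injectively is mapping it onto
itself. So intertwining in one direction is enough. -/
theorem mem_diagramGroup_of_intertwines {g : AffineGroup n} (hg : g ∈ extAffineWeyl n)
    (h : ∀ k ≤ n, ∃ l ≤ n, g * s n k = s n l * g) : g ∈ diagramGroup n := by
  refine ⟨hg, Subgroup.mem_normalizer_iff_conj_image_eq.2 ?_⟩
  have hfin : (simpleReflections n).Finite := (Set.finite_Icc 0 n).image _
  refine Set.eq_of_subset_of_ncard_le ?_
    (Set.ncard_image_of_injective _ (MulAut.conj g).injective).ge hfin
  rintro _ ⟨_, ⟨k, hk, rfl⟩, rfl⟩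
  obtain ⟨l, hl, e⟩ := h k hk.2
  refine ⟨l, ⟨by simp, hl⟩, ?_⟩
  rw [MulAut.conj_apply, e, mul_inv_cancel_right]

theorem coord_s_of_le (hn : 2 ≤ n) {j : ℕ} (hj : j ≤ n) (x : Fin n → ℝ) (k : ℕ) :
    coord (s n j x) k =
      if j = 0 then (if k = 1 then 1 - coord x 2 else if k = 2 then 1 - coord x 1 else coord x k)
      else if j = n then
        (if k = n - 1 then -coord x n else if k = n then -coord x (n - 1) else coord x k)
      else (if k = j then coord x (j + 1) else if k = j + 1 then coord x j else coord x k) := by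
  by_cases h0 : j = 0
  · subst h0
    rw [coord_s_zero hn, if_pos rfl]
  by_cases h1 : j = n
  · subst h1
    rw [coord_s_last hn, if_neg h0, if_pos rfl]
  · rw [coord_s (by omega) (by omega), if_neg h0, if_neg h1]

theorem diagramAut_first_mem (hn : 4 ≤ n) : diagramAut n 1 ∈ diagramGroup n := by
  refine mem_diagramGroup_of_intertwines (diagramAut_mem_extAffineWeyl hn (by omega))
    -- The diagram automorphism exchanging the two end nodes of each fork.
    fun k hk => ⟨if k = 0 then 1 else if k = 1 then 0 else if k = n - 1 then n
      else if k = n then n - 1 else k, by grind, ?_⟩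
  ext1 x
  refine coord_ext fun p hp hpn => ?_
  have hc := fun {k} => @coord_diagramAut_first n hn x k
  rw [mul_apply, mul_apply, coord_diagramAut_first hn _ hp hpn,
    coord_s_of_le (by omega) (by grind) (diagramAut n 1 x) p]
  simp only [coord_s_of_le (show 2 ≤ n by omega) hk]
  grind

theorem diagramAut_last_mem (hn : 4 ≤ n) : diagramAut n n ∈ diagramGroup n := by
  have hc := fun x {k} => @coord_diagramAut_last n hn x k
  rcases Nat.even_or_odd n with hp | hp
  · rw [hp.add_one.neg_one_pow] at hc
    refine mem_diagramGroup_of_intertwines (diagramAut_mem_extAffineWeyl hn (by omega))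
      fun k hk => ⟨n - k, by omega, ?_⟩
    ext1 x
    refine coord_ext fun p hp hpn => ?_
    have hc' := fun {k} => @hc x k
    rw [mul_apply, mul_apply, hc _ hp hpn, coord_s_of_le (by omega) (by omega) (diagramAut n n x) p]
    simp only [coord_s_of_le (show 2 ≤ n by omega) hk]
    clear hc
    grind (splits := 30)
  · rw [hp.add_one.neg_one_pow] at hc
    refine mem_diagramGroup_of_intertwines (diagramAut_mem_extAffineWeyl hn (by omega))
      -- For odd $n$ the flip $k\mapsto n-k$ has to be corrected at one fork, which gives an
      -- automorphism of order 4.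
      fun k hk => ⟨if k = n then 1 else if k = n - 1 then 0 else n - k, by grind, ?_⟩
    ext1 x
    refine coord_ext fun p hp hpn => ?_
    have hc' := fun {k} => @hc x k
    rw [mul_apply, mul_apply, hc _ hp hpn, coord_s_of_le (by omega) (by grind) (diagramAut n n x) p]
    simp only [coord_s_of_le (show 2 ≤ n by omega) hk]
    clear hc
    grind (splits := 30)

theorem diagramAut_penultimate_mem (hn : 4 ≤ n) : diagramAut n (n - 1) ∈ diagramGroup n := by
  have hc := fun x {k} => @coord_diagramAut_penultimate n hn x k
  rcases Nat.even_or_odd n with hp | hp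
  · rw [hp.add_one.neg_one_pow] at hc
    refine mem_diagramGroup_of_intertwines (diagramAut_mem_extAffineWeyl hn (by omega))
      fun k hk => ⟨if k = 0 then n - 1 else if k = 1 then n else if k = n then 1
        else if k = n - 1 then 0 else n - k, by grind, ?_⟩
    ext1 x
    refine coord_ext fun p hp hpn => ?_
    have hc' := fun {k} => @hc x k
    rw [mul_apply, mul_apply, hc _ hp hpn,
      coord_s_of_le (by omega) (by grind) (diagramAut n (n - 1) x) p]
    simp only [coord_s_of_le (show 2 ≤ n by omega) hk]
    clear hc
    grind (splits := 30)
  · rw [hp.add_one.neg_one_pow] at hc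
    refine mem_diagramGroup_of_intertwines (diagramAut_mem_extAffineWeyl hn (by omega))
      fun k hk => ⟨if k = 0 then n - 1 else if k = 1 then n else n - k, by grind, ?_⟩
    ext1 x
    refine coord_ext fun p hp hpn => ?_
    have hc' := fun {k} => @hc x k
    rw [mul_apply, mul_apply, hc _ hp hpn,
      coord_s_of_le (by omega) (by grind) (diagramAut n (n - 1) x) p]
    simp only [coord_s_of_le (show 2 ≤ n by omega) hk]
    clear hc
    grind (splits := 30)

/-! ### The expressions of the fundamental weights -/

/-- The power of the rotation word moves everything `i` places to the right and adds 1 to the first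
`i` places; the cyclic word is the rotation by `i` places to the left. -/
theorem translation_eq_rotation_mul_cyclic (hn : 4 ≤ n) {m i : ℕ} (him : i = m + m) (hi : 1 ≤ i)
    (hin : i ≤ n - 2) :
    translation n (fundamentalWeight n i) = 1 * wordProd n
      (wordPow ([0] ++ block 2 (n - 1) ++ block 1 (n - 2) ++ [n]) (i / 2) ++ cyclicWord n i) := by
  ext1 x
  refine coord_ext fun p hp hpn => ?_
  rw [one_mul, wordProd_append, mul_apply, coord_translation, coord_fundamentalWeight hn hp hpn,
    coord_rotation_pow hn _ (by omega) _ hp hpn]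
  split_ifs <;> first | omega | rw [coord_cyclicWord hi (by omega) _ (by omega) (by omega)]
  all_goals grind

theorem coord_block_last (hn : 4 ≤ n) (x : Fin n → ℝ) (p : ℕ) :
    coord (wordProd n (block 1 (n - 2) ++ [n]) x) p =
      if p = 1 then -coord x n else if p + 1 ≤ n ∧ 1 ≤ p then coord x (p - 1)
      else if p = n then -coord x (n - 1) else coord x p := by
  rw [wordProd_append, mul_apply, wordProd_singleton]
  simp only [coord_s_last (show 2 ≤ n by omega),
    coord_block (show 1 ≤ 1 by omega) (show 1 ≤ n - 2 by omega) (show n - 2 < n by omega)]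
  grind

theorem coord_diagramAut_first_mul (hn : 4 ≤ n) (x : Fin n → ℝ) {p : ℕ} (hp : 1 ≤ p)
    (hpn : p ≤ n) :
    coord ((diagramAut n 1 * wordProd n (block 1 (n - 2) ++ [n])) x) p =
      if p = 1 then 1 + coord x n else coord x (p - 1) := by
  rw [mul_apply, coord_diagramAut_first hn _ hp hpn]
  simp only [coord_block_last hn]
  grind

theorem translation_eq_first_mul_rotation_mul_cyclic (hn : 4 ≤ n) {m i : ℕ} (him : i = 2 * m + 1)
    (hin : i ≤ n - 2) :
    translation n (fundamentalWeight n i) = diagramAut n 1 * wordProd n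
      (block 1 (n - 2) ++ [n] ++
        wordPow ([0] ++ block 2 (n - 1) ++ block 1 (n - 2) ++ [n]) ((i - 1) / 2)
        ++ cyclicWord n i) := by
  ext1 x
  refine coord_ext fun p hp hpn => ?_
  rw [wordProd_append, wordProd_append, ← mul_assoc, ← mul_assoc, mul_apply, mul_apply,
    coord_translation, coord_fundamentalWeight hn hp hpn, coord_diagramAut_first_mul hn _ hp hpn]
  split_ifs <;> first | omega | rw [coord_rotation_pow hn _ (by omega) _ (by omega) (by omega)]
  all_goals
    split_ifs <;> first | omega | rw [coord_cyclicWord (by omega) (by omega) _ (by omega) (by omega)]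
    all_goals grind

theorem coord_last_block (hn : 4 ≤ n) (x : Fin n → ℝ) (p : ℕ) :
    coord (wordProd n ([n] ++ block 1 (n - 1)) x) p =
      if p = 1 then coord x n else if p = n then -coord x (n - 2)
      else if p = n - 1 then -coord x (n - 1)
      else if 1 ≤ p ∧ p ≤ n then coord x (p - 1) else coord x p := by
  rw [wordProd_append, mul_apply, wordProd_singleton]
  simp only [coord_s_last (show 2 ≤ n by omega),
    coord_block (show 1 ≤ 1 by omega) (show 1 ≤ n - 1 by omega) (show n - 1 < n by omega)]
  grind

theorem coord_penultimate_pair (hn : 4 ≤ n) (x : Fin n → ℝ) (p : ℕ) :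
    coord (wordProd n ([n - 1] ++ [n - 2]) x) p =
      if p = n - 2 then coord x (n - 1) else if p = n - 1 then coord x n
      else if p = n then coord x (n - 2) else coord x p := by
  rw [wordProd_append, mul_apply, wordProd_singleton, wordProd_singleton]
  simp only [coord_s (show 1 ≤ n - 1 by omega) (show n - 1 < n by omega),
    coord_s (show 1 ≤ n - 2 by omega) (show n - 2 < n by omega)]
  grind

theorem coord_rChain_two (t : ℕ) (hn : 2 * t + 4 ≤ n) (x : Fin n → ℝ) {p : ℕ} (hp : 1 ≤ p)
    (hpn : p ≤ n) :
    coord (wordProd n (rChain n (2 + 2 * t) 2 ++ [n]) x) p =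
      if p ≤ 2 + 2 * t then -coord x (n + 1 - p)
      else if p + 2 ≤ n then coord x (p - 2 * (t + 1)) else -coord x (2 * n - 2 * t - 3 - p) := by
  rw [wordProd_append, mul_apply, wordProd_singleton, coord_rChain le_rfl (by omega) _ hp hpn]
  simp only [coord_s_last (show 2 ≤ n by omega)]
  split_ifs <;> grind

theorem coord_rChain_three (t : ℕ) (hn : 2 * t + 5 ≤ n) (x : Fin n → ℝ) {p : ℕ} (hp : 1 ≤ p)
    (hpn : p ≤ n) :
    coord (wordProd n (rChain n (3 + 2 * t) 3 ++ ([n] ++ block 1 (n - 1))) x) p =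
      if p = 1 then coord x n else if p ≤ 3 + 2 * t then -coord x (n + 1 - p)
      else if p + 2 ≤ n then coord x (p - 2 * t - 3) else -coord x (2 * n - 2 * t - 4 - p) := by
  rw [wordProd_append, mul_apply, coord_rChain (by omega) (by omega) _ hp hpn]
  simp only [coord_last_block (show 4 ≤ n by omega)]
  split_ifs <;> grind

/-- Here the chain runs up to `n - 2`, so its product with $s_n$ is the full negated reversal, which
the linear part of $\pi_n$ inverts for even $n$. -/
theorem translation_last_even {t : ℕ} (hn : n = 2 * t + 4) :
    translation n (fundamentalWeight n n) =
      diagramAut n n * wordProd n (rChain n (n - 2) 2 ++ [n]) := by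
  ext1 x
  refine coord_ext fun p hp hpn => ?_
  have hs : ((-1 : ℝ)) ^ (n + 1) = -1 := Odd.neg_one_pow ⟨t + 2, by omega⟩
  rw [mul_apply, coord_diagramAut_last (by omega) _ hp hpn, coord_translation,
    coord_fundamentalWeight (by omega) hp hpn, hs, show n - 2 = 2 + 2 * t by omega,
    coord_rChain_two t (by omega) x (by omega) le_rfl,
    coord_rChain_two t (by omega) x (show 1 ≤ n + 1 - p by omega) (by omega)]
  split_ifs <;> grind

/-- The chain stops at `n - 3` and leaves $x_1,-x_3,-x_2$ in the last three places. The two extra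
letters cycle them to $-x_3,-x_2,x_1$; the unnegated $x_1$ agrees with the sign in $\pi_n$ for odd
$n$. -/
theorem translation_last_odd {t : ℕ} (hn : n = 2 * t + 5) :
    translation n (fundamentalWeight n n) =
      diagramAut n n * wordProd n ([n - 1] ++ [n - 2] ++ rChain n (n - 3) 2 ++ [n]) := by
  ext1 x
  refine coord_ext fun p hp hpn => ?_
  have hs : ((-1 : ℝ)) ^ (n + 1) = 1 := Even.neg_one_pow ⟨t + 3, by omega⟩
  rw [mul_apply, coord_diagramAut_last (by omega) _ hp hpn, coord_translation,
    coord_fundamentalWeight (by omega) hp hpn, List.append_assoc, wordProd_append, mul_apply, hs,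
    show n - 3 = 2 + 2 * t by omega]
  simp only [coord_penultimate_pair (show 4 ≤ n by omega)]
  rw [coord_rChain_two t (by omega) x (show 1 ≤ n - 2 by omega) (by omega),
    coord_rChain_two t (by omega) x (show 1 ≤ n - 1 by omega) (by omega),
    coord_rChain_two t (by omega) x (show 1 ≤ n by omega) (by omega),
    coord_rChain_two t (by omega) x (show 1 ≤ n + 1 - p by omega) (by omega)]
  split_ifs <;> grind

theorem translation_penultimate_even {t : ℕ} (hn : n = 2 * t + 5) :
    translation n (fundamentalWeight n (n - 1)) =
      diagramAut n (n - 1) * wordProd n (rChain n (n - 2) 3 ++ [n] ++ block 1 (n - 1)) := by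
  ext1 x
  refine coord_ext fun p hp hpn => ?_
  have hs : ((-1 : ℝ)) ^ (n + 1) = 1 := Even.neg_one_pow ⟨t + 3, by omega⟩
  rw [mul_apply, coord_diagramAut_penultimate (by omega) _ hp hpn, coord_translation,
    coord_fundamentalWeight (by omega) hp hpn, List.append_assoc, hs,
    show n - 2 = 3 + 2 * t by omega,
    coord_rChain_three t (by omega) x (show 1 ≤ 1 by omega) (by omega),
    coord_rChain_three t (by omega) x (show 1 ≤ n by omega) (by omega),
    coord_rChain_three t (by omega) x (show 1 ≤ n + 1 - p by omega) (by omega)]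
  split_ifs <;> grind

theorem translation_penultimate_odd {t : ℕ} (hn : n = 2 * t + 6) :
    translation n (fundamentalWeight n (n - 1)) =
      diagramAut n (n - 1) * wordProd n
        ([n - 1] ++ [n - 2] ++ rChain n (n - 3) 3 ++ [n] ++ block 1 (n - 1)) := by
  ext1 x
  refine coord_ext fun p hp hpn => ?_
  have hs : ((-1 : ℝ)) ^ (n + 1) = -1 := Odd.neg_one_pow ⟨t + 3, by omega⟩
  rw [mul_apply, coord_diagramAut_penultimate (by omega) _ hp hpn, coord_translation,
    coord_fundamentalWeight (by omega) hp hpn, List.append_assoc, List.append_assoc,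
    wordProd_append, mul_apply, hs, show n - 3 = 3 + 2 * t by omega]
  have hr := fun {p} (hp : 1 ≤ p) (hpn : p ≤ n) =>
    coord_rChain_three (n := n) t (by omega) x (p := p) hp hpn
  have e1 := hr (show 1 ≤ 1 by omega) (by omega)
  have e2 := hr (show 1 ≤ n - 2 by omega) (by omega)
  have e3 := hr (show 1 ≤ n - 1 by omega) (by omega)
  have e4 := hr (show 1 ≤ n by omega) le_rfl
  rw [if_pos rfl] at e1
  rw [if_neg (by omega), if_neg (by omega), if_pos (by omega),
    show n - 2 - 2 * t - 3 = 1 by omega] at e2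
  rw [if_neg (by omega), if_neg (by omega), if_neg (by omega),
    show 2 * n - 2 * t - 4 - (n - 1) = 3 by omega] at e3
  rw [if_neg (by omega), if_neg (by omega), if_neg (by omega),
    show 2 * n - 2 * t - 4 - n = 2 by omega] at e4
  simp only [coord_penultimate_pair (show 4 ≤ n by omega)]
  rw [e1, e2, e3, e4, hr (show 1 ≤ n + 1 - p by omega) (by omega)]
  clear hr e1 e2 e3 e4
  grind (splits := 20)

/-- The case of an empty chain, which the parametrization by `3 + 2 * t` does not cover. -/
theorem translation_penultimate_four :
    translation 4 (fundamentalWeight 4 3) =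
      diagramAut 4 3 * wordProd 4 ([3] ++ [2] ++ rChain 4 1 3 ++ [4] ++ block 1 3) := by
  ext1 x
  refine coord_ext fun p hp hpn => ?_
  have hd := coord_diagramAut_penultimate (n := 4) le_rfl
    (wordProd 4 ([3] ++ [2] ++ rChain 4 1 3 ++ [4] ++ block 1 3) x) hp hpn
  have h1 := fun y p => coord_penultimate_pair (n := 4) le_rfl y p
  have h2 := fun y p => coord_last_block (n := 4) le_rfl y p
  simp only [Nat.reduceSub] at hd h1 h2
  rw [mul_apply, hd, coord_translation, coord_fundamentalWeight le_rfl hp hpn,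
    rChain_of_lt (by omega), List.append_nil, List.append_assoc, wordProd_append, mul_apply]
  simp only [h1, h2]
  grind

/-! ### The lengths -/

theorem sep_fundamentalWeight (hn : 4 ≤ n) {i : ℕ} (hin : i + 2 ≤ n) :
    (sep (basePoint n - fundamentalWeight n i) : ℝ) = i * (2 * n - i - 1) := by
  rw [sep_basePoint_sub]
  -- Partial sums up to `m` make induction possible; they stop growing once `m` exceeds `i`, whence
  -- the minimum.
  · have h : ∀ m ≤ n, ∑ a ∈ Finset.Icc 1 m, 2 * ((n : ℝ) - a) * coord (fundamentalWeight n i) a =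
        (min i m : ℕ) * (2 * n - (min i m : ℕ) - 1) := by
      intro m hm
      induction m with
      | zero => simp
      | succ m ih =>
        rw [Finset.sum_Icc_succ_top (by omega), ih (by omega),
          coord_fundamentalWeight hn (by omega) hm, if_pos hin]
        split_ifs with hmi
        · rw [min_eq_right hmi, min_eq_right (by omega)]
          push_cast; ring
        · rw [min_eq_left (by omega), min_eq_left (by omega)]
          ring
    rw [h n le_rfl, min_eq_left (by omega)]
  · intro a b ha hab hb
    simp only [coord_fundamentalWeight hn ha (show a ≤ n by omega),
      coord_fundamentalWeight hn (show 1 ≤ b by omega) hb, if_pos hin]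
    refine ⟨(if a ≤ i then 1 else 0) - if b ≤ i then 1 else 0,
      (if a ≤ i then 1 else 0) + if b ≤ i then 1 else 0, ?_, ?_, ?_, ?_⟩
    · grind
    · grind
    · push_cast; rfl
    · push_cast; rfl

/-- The last coordinate enters with factor $n-n=0$, so its sign is irrelevant and both spin weights
give the same sum. -/
theorem sep_spinWeight (hn : 4 ≤ n) {i : ℕ} (hi : n ≤ i + 1) :
    (sep (basePoint n - fundamentalWeight n i) : ℝ) = n * (n - 1) / 2 := by
  rw [sep_basePoint_sub]
  · have h : ∀ a ∈ Finset.Icc 1 n, 2 * ((n : ℝ) - a) * coord (fundamentalWeight n i) a =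
        (n : ℝ) - a := by
      intro a ha
      rw [Finset.mem_Icc] at ha
      rw [coord_fundamentalWeight hn ha.1 ha.2, if_neg (by omega)]
      split_ifs with h
      · rw [h.2]; ring
      · ring
    have h2 : ∀ m : ℕ, ∑ a ∈ Finset.Icc 1 m, ((n : ℝ) - a) = m * n - m * (m + 1) / 2 := by
      intro m
      induction m with
      | zero => simp
      | succ m ih =>
        rw [Finset.sum_Icc_succ_top (by omega), ih]
        push_cast; ring
    rw [Finset.sum_congr rfl h, h2]
    ring
  · intro a b ha hab hb
    simp only [coord_fundamentalWeight hn ha (show a ≤ n by omega),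
      coord_fundamentalWeight hn (show 1 ≤ b by omega) hb, if_neg (show ¬ i + 2 ≤ n by omega),
      if_neg (show ¬ (i + 1 = n ∧ a = n) by omega)]
    split_ifs
    · exact ⟨1, 0, by norm_num, by norm_num, by norm_num, by norm_num⟩
    · exact ⟨0, 1, by norm_num, by norm_num, by norm_num, by norm_num⟩

theorem length_rotationWord (hn : 2 ≤ n) :
    ([0] ++ block 2 (n - 1) ++ block 1 (n - 2) ++ [n]).length = 2 * n - 2 := by
  simp [length_block]; omega

theorem length_rotationWord_cyclic (hn : 4 ≤ n) {m i : ℕ} (him : i = m + m) (hi : 1 ≤ i)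
    (hin : i ≤ n - 2) :
    (wordPow ([0] ++ block 2 (n - 1) ++ block 1 (n - 2) ++ [n]) (i / 2)
      ++ cyclicWord n i).length = i * (2 * n - i - 1) := by
  rw [List.length_append, length_wordPow, length_rotationWord (by omega),
    length_cyclicWord hi (by omega), show i / 2 = m by omega]
  obtain ⟨d, rfl⟩ := Nat.exists_eq_add_of_le (show i + 2 ≤ n by omega)
  rw [show 2 * (i + 2 + d) - 2 = 2 * (i + 1 + d) by omega, show i + 2 + d - i = 2 + d by omega,
    show 2 * (i + 2 + d) - i - 1 = i + 3 + 2 * d by omega, him]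
  ring

theorem length_first_rotationWord_cyclic (hn : 4 ≤ n) {m i : ℕ} (him : i = 2 * m + 1)
    (hin : i ≤ n - 2) :
    (block 1 (n - 2) ++ [n] ++
      wordPow ([0] ++ block 2 (n - 1) ++ block 1 (n - 2) ++ [n]) ((i - 1) / 2)
        ++ cyclicWord n i).length = i * (2 * n - i - 1) := by
  rw [List.length_append, List.length_append, List.length_append, length_wordPow,
    length_rotationWord (by omega), length_block, List.length_singleton,
    length_cyclicWord (by omega) (by omega), show (i - 1) / 2 = m by omega]
  obtain ⟨d, rfl⟩ := Nat.exists_eq_add_of_le (show i + 2 ≤ n by omega)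
  rw [show 2 * (i + 2 + d) - 2 = 2 * (i + 1 + d) by omega, show i + 2 + d - i = 2 + d by omega,
    show 2 * (i + 2 + d) - i - 1 = i + 3 + 2 * d by omega,
    show i + 2 + d - 2 + 1 - 1 = i + d by omega, him]
  ring

theorem length_last_even {t : ℕ} (hn : n = 2 * t + 4) :
    2 * (rChain n (n - 2) 2 ++ [n]).length = n * (n - 1) := by
  rw [show n - 2 = 2 + 2 * t by omega, List.length_append, length_rChain le_rfl (by omega),
    show n - 2 - t = t + 2 by omega, show n - 1 = 2 * t + 3 by omega, hn, List.length_singleton]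
  ring

theorem length_last_odd {t : ℕ} (hn : n = 2 * t + 5) :
    2 * ([n - 1] ++ [n - 2] ++ rChain n (n - 3) 2 ++ [n]).length = n * (n - 1) := by
  simp only [List.length_append, List.length_singleton]
  rw [show n - 3 = 2 + 2 * t by omega, length_rChain le_rfl (by omega),
    show n - 2 - t = t + 3 by omega, show n - 1 = 2 * t + 4 by omega, hn]
  ring

theorem length_penultimate_even {t : ℕ} (hn : n = 2 * t + 5) :
    2 * (rChain n (n - 2) 3 ++ [n] ++ block 1 (n - 1)).length = n * (n - 1) := by
  simp only [List.length_append, List.length_singleton]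
  rw [show n - 2 = 3 + 2 * t by omega, length_rChain (by omega) (by omega), length_block,
    show n - 3 - t = t + 2 by omega, show n - 1 + 1 - 1 = 2 * t + 4 by omega,
    show n - 1 = 2 * t + 4 by omega, hn]
  ring

theorem length_penultimate_odd {t : ℕ} (hn : n = 2 * t + 6) :
    2 * ([n - 1] ++ [n - 2] ++ rChain n (n - 3) 3 ++ [n] ++ block 1 (n - 1)).length
      = n * (n - 1) := by
  simp only [List.length_append, List.length_singleton]
  rw [show n - 3 = 3 + 2 * t by omega, length_rChain (by omega) (by omega), length_block,
    show n - 3 - t = t + 3 by omega, show n - 1 + 1 - 1 = 2 * t + 5 by omega,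
    show n - 1 = 2 * t + 5 by omega, hn]
  ring

/-! ### Reduced expressions of the fundamental weights -/

theorem isReducedExpression_fundamentalWeight (hn : 4 ≤ n) {i : ℕ} {lam : AffineGroup n}
    {L : List ℕ} (hin : i ≤ n - 2) (hlam : lam ∈ diagramGroup n) (hL : ∀ j ∈ L, j ≤ n)
    (h : translation n (fundamentalWeight n i) = lam * wordProd n L)
    (hlen : L.length = i * (2 * n - i - 1)) :
    IsReducedExpression n (translation n (fundamentalWeight n i)) lam L := by
  refine isReducedExpression_translation hn hlam hL h ?_
  rw [hlen, sep_fundamentalWeight hn (by omega), Nat.cast_mul, Nat.cast_sub (by omega),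
    Nat.cast_sub (by omega)]
  push_cast
  ring

theorem isReducedExpression_spinWeight (hn : 4 ≤ n) {i : ℕ} {lam : AffineGroup n}
    {L : List ℕ} (hi : n ≤ i + 1) (hlam : lam ∈ diagramGroup n) (hL : ∀ j ∈ L, j ≤ n)
    (h : translation n (fundamentalWeight n i) = lam * wordProd n L)
    (hlen : 2 * L.length = n * (n - 1)) :
    IsReducedExpression n (translation n (fundamentalWeight n i)) lam L := by
  refine isReducedExpression_translation hn hlam hL h ?_
  have h2 : (2 * L.length : ℝ) = n * (n - 1) := by
    have := congrArg (Nat.cast (R := ℝ)) hlen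
    rw [Nat.cast_mul, Nat.cast_mul, Nat.cast_sub (by omega)] at this
    exact_mod_cast this
  rw [sep_spinWeight hn hi, ← h2]
  ring

theorem le_of_mem_rotationWord {j : ℕ}
    (h : j ∈ [0] ++ block 2 (n - 1) ++ block 1 (n - 2) ++ [n]) : j ≤ n := by
  simp only [List.mem_append, List.mem_singleton] at h
  obtain ((h | h) | h) | h := h
  · omega
  · exact le_of_mem_block (by omega) h
  · exact le_of_mem_block (by omega) h
  · omega

theorem isReducedExpression_even (hn : 4 ≤ n) {i : ℕ} (hi : Even i) (hi2 : 2 ≤ i)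
    (hin : i ≤ n - 2) :
    IsReducedExpression n (translation n (fundamentalWeight n i)) 1
      (wordPow ([0] ++ block 2 (n - 1) ++ block 1 (n - 2) ++ [n]) (i / 2) ++ cyclicWord n i) := by
  obtain ⟨m, hm⟩ := hi
  refine isReducedExpression_fundamentalWeight hn hin (one_mem _) (fun j hj => ?_)
    (translation_eq_rotation_mul_cyclic hn hm (by omega) hin)
    (length_rotationWord_cyclic hn hm (by omega) hin)
  rcases List.mem_append.1 hj with h | h
  · exact le_of_mem_wordPow (fun _ => le_of_mem_rotationWord) h
  · exact le_of_mem_cyclicWord h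

theorem isReducedExpression_odd (hn : 4 ≤ n) {i : ℕ} (hi : Odd i) (hin : i ≤ n - 2) :
    IsReducedExpression n (translation n (fundamentalWeight n i)) (diagramAut n 1)
      (block 1 (n - 2) ++ [n] ++
        wordPow ([0] ++ block 2 (n - 1) ++ block 1 (n - 2) ++ [n]) ((i - 1) / 2)
        ++ cyclicWord n i) := by
  obtain ⟨m, hm⟩ := hi
  refine isReducedExpression_fundamentalWeight hn hin (diagramAut_first_mem hn) (fun j hj => ?_)
    (translation_eq_first_mul_rotation_mul_cyclic hn hm hin)
    (length_first_rotationWord_cyclic hn hm hin)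
  simp only [List.mem_append (s := block 1 (n - 2)), List.mem_append (t := cyclicWord n i),
    List.mem_append (s := block 1 (n - 2) ++ [n]), List.mem_singleton] at hj
  obtain ((h | h) | h) | h := hj
  · exact le_of_mem_block (by omega) h
  · omega
  · exact le_of_mem_wordPow (fun _ => le_of_mem_rotationWord) h
  · exact le_of_mem_cyclicWord h

theorem isReducedExpression_penultimate_even (hn : 4 ≤ n) (hp : Even (n - 1)) :
    IsReducedExpression n (translation n (fundamentalWeight n (n - 1))) (diagramAut n (n - 1))
      (rChain n (n - 2) 3 ++ [n] ++ block 1 (n - 1)) := by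
  obtain ⟨m, hm⟩ := hp
  have ht : n = 2 * (m - 2) + 5 := by omega
  refine isReducedExpression_spinWeight hn (by omega) (diagramAut_penultimate_mem hn)
    (fun j hj => ?_) (translation_penultimate_even ht) (length_penultimate_even ht)
  simp only [List.mem_append, List.mem_singleton] at hj
  obtain (h | h) | h := hj
  · exact le_of_mem_rChain h
  · omega
  · exact le_of_mem_block (by omega) h

theorem isReducedExpression_penultimate_odd (hn : 4 ≤ n) (hp : Odd (n - 1)) :
    IsReducedExpression n (translation n (fundamentalWeight n (n - 1))) (diagramAut n (n - 1))
      ([n - 1] ++ [n - 2] ++ rChain n (n - 3) 3 ++ [n] ++ block 1 (n - 1)) := by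
  obtain ⟨m, hm⟩ := hp
  refine isReducedExpression_spinWeight hn (by omega) (diagramAut_penultimate_mem hn)
    (fun j hj => ?_) ?_ ?_
  · simp only [List.mem_append, List.mem_singleton] at hj
    obtain (((h | h) | h) | h) | h := hj
    · omega
    · omega
    · exact le_of_mem_rChain h
    · omega
    · exact le_of_mem_block (by omega) h
  all_goals rcases hn.eq_or_lt with rfl | hn'
  · exact translation_penultimate_four
  · exact translation_penultimate_odd (t := m - 2) (by omega)
  · rfl
  · exact length_penultimate_odd (t := m - 2) (by omega)

theorem isReducedExpression_last_even (hn : 4 ≤ n) (hp : Even n) :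
    IsReducedExpression n (translation n (fundamentalWeight n n)) (diagramAut n n)
      (rChain n (n - 2) 2 ++ [n]) := by
  obtain ⟨m, hm⟩ := hp
  have ht : n = 2 * (m - 2) + 4 := by omega
  refine isReducedExpression_spinWeight hn (by omega) (diagramAut_last_mem hn)
    (fun j hj => ?_) (translation_last_even ht) (length_last_even ht)
  simp only [List.mem_append, List.mem_singleton] at hj
  obtain h | h := hj
  · exact le_of_mem_rChain h
  · omega

theorem isReducedExpression_last_odd (hn : 4 ≤ n) (hp : Odd n) :
    IsReducedExpression n (translation n (fundamentalWeight n n)) (diagramAut n n)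
      ([n - 1] ++ [n - 2] ++ rChain n (n - 3) 2 ++ [n]) := by
  obtain ⟨m, hm⟩ := hp
  have ht : n = 2 * (m - 2) + 5 := by omega
  refine isReducedExpression_spinWeight hn (by omega) (diagramAut_last_mem hn)
    (fun j hj => ?_) (translation_last_odd ht) (length_last_odd ht)
  simp only [List.mem_append, List.mem_singleton] at hj
  obtain ((h | h) | h) | h := hj
  · omega
  · omega
  · exact le_of_mem_rChain h
  · omega

theorem extLength_fundamentalWeight (hn : 4 ≤ n) {i : ℕ} (hi : 1 ≤ i) (hin : i ≤ n - 2) :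
    extLength n (translation n (fundamentalWeight n i)) = i * (2 * n - i - 1) := by
  rcases Nat.even_or_odd i with hp | hp
  · have h := isReducedExpression_even hn hp (by grind) hin
    obtain ⟨m, hm⟩ := hp
    rw [← h.2.2.2, length_rotationWord_cyclic hn hm hi hin]
  · have h := isReducedExpression_odd hn hp hin
    obtain ⟨m, hm⟩ := hp
    rw [← h.2.2.2, length_first_rotationWord_cyclic hn hm hin]

theorem IsReducedExpression.extLength_eq {g lam : AffineGroup n} {L : List ℕ} {N : ℕ}
    (h : IsReducedExpression n g lam L) (hlen : 2 * L.length = N) : extLength n g = N / 2 := by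
  rw [← h.2.2.2]; omega

theorem extLength_penultimateWeight (hn : 4 ≤ n) :
    extLength n (translation n (fundamentalWeight n (n - 1))) = n * (n - 1) / 2 := by
  rcases Nat.even_or_odd (n - 1) with hp | hp
  · refine (isReducedExpression_penultimate_even hn hp).extLength_eq ?_
    obtain ⟨m, hm⟩ := hp
    exact length_penultimate_even (t := m - 2) (by omega)
  · refine (isReducedExpression_penultimate_odd hn hp).extLength_eq ?_
    obtain ⟨m, hm⟩ := hp
    rcases hn.eq_or_lt with rfl | hn'
    · rfl
    · exact length_penultimate_odd (t := m - 2) (by omega)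

theorem extLength_lastWeight (hn : 4 ≤ n) :
    extLength n (translation n (fundamentalWeight n n)) = n * (n - 1) / 2 := by
  rcases Nat.even_or_odd n with hp | hp
  · refine (isReducedExpression_last_even hn hp).extLength_eq ?_
    obtain ⟨m, hm⟩ := hp
    exact length_last_even (t := m - 2) (by omega)
  · refine (isReducedExpression_last_odd hn hp).extLength_eq ?_
    obtain ⟨m, hm⟩ := hp
    exact length_last_odd (t := m - 2) (by omega)

end AffineD

end

/-! ### The theorem -/

theorem mainTheorem5 (n : ℕ) (hn : 4 ≤ n) :
    -- even `i`
    (∀ i, Even i → 2 ≤ i → i ≤ n - 2 →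
      AffineD.IsReducedExpression n (AffineD.translation n (AffineD.fundamentalWeight n i)) 1
        (AffineD.wordPow
            ([0] ++ AffineD.block 2 (n - 1) ++ AffineD.block 1 (n - 2) ++ [n]) (i / 2)
          ++ AffineD.cyclicWord n i)) ∧
    (Even (n - 1) →
      AffineD.IsReducedExpression n (AffineD.translation n (AffineD.fundamentalWeight n (n - 1)))
        (AffineD.diagramAut n (n - 1))
        (AffineD.rChain n (n - 2) 3 ++ [n] ++ AffineD.block 1 (n - 1))) ∧
    (Even n →
      AffineD.IsReducedExpression n (AffineD.translation n (AffineD.fundamentalWeight n n))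
        (AffineD.diagramAut n n)
        (AffineD.rChain n (n - 2) 2 ++ [n])) ∧
    -- odd `i`
    (∀ i, Odd i → 1 ≤ i → i ≤ n - 2 →
      AffineD.IsReducedExpression n (AffineD.translation n (AffineD.fundamentalWeight n i))
        (AffineD.diagramAut n 1)
        (AffineD.block 1 (n - 2) ++ [n]
          ++ AffineD.wordPow
            ([0] ++ AffineD.block 2 (n - 1) ++ AffineD.block 1 (n - 2) ++ [n]) ((i - 1) / 2)
          ++ AffineD.cyclicWord n i)) ∧
    (Odd (n - 1) →
      AffineD.IsReducedExpression n (AffineD.translation n (AffineD.fundamentalWeight n (n - 1)))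
        (AffineD.diagramAut n (n - 1))
        ([n - 1] ++ [n - 2] ++ AffineD.rChain n (n - 3) 3 ++ [n] ++ AffineD.block 1 (n - 1))) ∧
    (Odd n →
      AffineD.IsReducedExpression n (AffineD.translation n (AffineD.fundamentalWeight n n))
        (AffineD.diagramAut n n)
        ([n - 1] ++ [n - 2] ++ AffineD.rChain n (n - 3) 2 ++ [n])) ∧
    -- the lengths
    (∀ i, 1 ≤ i → i ≤ n - 2 →
      AffineD.extLength n (AffineD.translation n (AffineD.fundamentalWeight n i))
        = i * (2 * n - i - 1)) ∧
    AffineD.extLength n (AffineD.translation n (AffineD.fundamentalWeight n (n - 1)))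
      = n * (n - 1) / 2 ∧
    AffineD.extLength n (AffineD.translation n (AffineD.fundamentalWeight n n))
      = n * (n - 1) / 2 :=
  ⟨fun _ hi hi2 hin => AffineD.isReducedExpression_even hn hi hi2 hin,
    AffineD.isReducedExpression_penultimate_even hn,
    AffineD.isReducedExpression_last_even hn,
    fun _ hi _ hin => AffineD.isReducedExpression_odd hn hi hin,
    AffineD.isReducedExpression_penultimate_odd hn,
    AffineD.isReducedExpression_last_odd hn,
    fun _ hi hin => AffineD.extLength_fundamentalWeight hn hi hin,
    AffineD.extLength_penultimateWeight hn, AffineD.extLength_lastWeight hn⟩
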